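/- **Definitions.** Let $D=\{0,1\}$, let $E$ be a finite set and $\varphi:D\to E$ a map. A finite promise template $\Gamma$ over $(D,E,\varphi)$ is a finite family of pairs of relations $P_i\subseteq D^{\mathrm{ar}_i}$, $Q_i\subseteq E^{\mathrm{ar}_i}$ $(i\in I)$ such that $\varphi(P_i)\subseteq Q_i$ coordinatewise for all $i$. $\mathrm{PCSP}(\Gamma)$ is the promise decision problem whose inputs are formulas $\Psi=\bigwedge_{t}R_{i_t}(x_{t_1},\dots,x_{t_{\mathrm{ar}_{i_t}}})$ in variables $x_1,\dots,x_n$: accept if $\Psi$ is satisfiable over $D$ when every $R_i$ is read as $P_i$; reject if $\Psi$ is not satisfiable over $E$ when every $R_i$ is read as $Q_i$. A function $f:D^L\to E$, $L\ge 1$, is in $\mathrm{Pol}(\Gamma)$ if for all $i$, applying $f$ coordinatewise to any $L$ elements of $P_i$ gives an element of $Q_i$. A subring $A\subset\mathbb R$ (with $1$), whose elements are represented by bit strings, $\mathrm{size}(a)$ being the length of the given representation of $a$, is *efficiently computable* if: (1) a representation of $n\in\mathbb Z$ of size $\mathrm{poly}(\log(|n|+1))$ can be computed in polynomial time from the binary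 notation of $n$; (2) $2^{-\mathrm{poly}(\mathrm{size}(a))}<a<2^{\mathrm{poly}(\mathrm{size}(a))}$ for all $a\in A$, $a>0$; (3) $+,-,\times,=,<$ are computable in polynomial time on representations; (4) there is a constant $C>0$ such that the result of each of $+,-,\times$ on $a,a'$ has size at most $C(\mathrm{size}(a)+\mathrm{size}(a'))$. It is *LP-solvable* if moreover there is an algorithm that, given $M\in\mathbb Z^{m\times n}$ and $c\in\mathbb Z^m$, in time polynomial in $n+m$ and the bit size of $(M,c)$ outputs some $x\in A^n$ with $Mx\le c$, or reports that no such $x\in A^n$ exists. Let $A_1,\dots,A_b$ be dense subrings of $\mathbb R$, $\mathfrak A=(A_1\times\cdots\times A_b)\cap[0,1]^b$, and $S$ a finite set. A map $\mathrm{Part}:\mathfrak A\to S$ is an *open partition* if every $x\in\mathfrak A$ has an $\epsilon>0$ with $\mathrm{Part}(y)=\mathrm{Part}(x)$ for all $y\in\mathfrak A$ with $|x-y|<\epsilon$. For $x\in[0,1]^b$ put $\overline{\mathrm{Part}}(x)=k$ if for some $\epsilon>0$ we have $\mathrm{Part}(y)=k$ for all $y\in\mathfrak A$ with $|x-y|<\epsilon$,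 and $\overline{\mathrm{Part}}(x)=\perp$ if there is no such $k\in S$. For $k\in S$ let $J_k$ be an ideal of the ring $\mathbb Z^b$ with $\mathbb Z^b/J_k$ finite and let $M_k:\mathbb Z^b/J_k\to E$ be a map; $\mathcal M=\{M_k:k\in S\}$. Let $\mathcal B=(B_1,\dots,B_b)$ be a partition of $\{1,\dots,L\}$ into nonempty blocks such that $\overline{\mathrm{Part}}(k_1/|B_1|,\dots,k_b/|B_b|)\ne\perp$ for all integers $0\le k_j\le|B_j|$. With $\mathrm{Ham}_{B_j}(x)=\sum_{l\in B_j}x_l$, the function $\mathrm{REG\text{-}PER}_{\mathrm{Part},\mathcal B,\mathcal M}:D^L\to E$ is $$x\mapsto M_k\bigl((\mathrm{Ham}_{B_1}(x),\dots,\mathrm{Ham}_{B_b}(x))\bmod J_k\bigr),\qquad k=\overline{\mathrm{Part}}\Bigl(\tfrac{\mathrm{Ham}_{B_1}(x)}{|B_1|},\dots,\tfrac{\mathrm{Ham}_{B_b}(x)}{|B_b|}\Bigr).$$ **Theorem.** Let $A_1,\dots,A_b\subset\mathbb R$ be dense LP-solvable subrings, $\mathrm{Part}:\mathfrak A\to S$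 an open partition into finitely many regions, $\mathcal M=\{M_k:\mathbb Z^b/J_k\to E\mid k\in S\}$ a collection of maps as above, with all $\mathbb Z^b/J_k$ finite, and $\Gamma$ a finite promise template over $(\{0,1\},E,\varphi)$ with $E$ finite. Assume that for every positive integer $\ell$ there is a partition $\mathcal B$ as above with $|B_j|\ge\ell$ for all $j$ and $\mathrm{REG\text{-}PER}_{\mathrm{Part},\mathcal B,\mathcal M}\in\mathrm{Pol}(\Gamma)$. Then $\mathrm{PCSP}(\Gamma)\in\mathsf P^{\mathrm{Part}}$: the promise decision problem $\mathrm{PCSP}(\Gamma)$ can be solved in polynomial time by a machine with oracle access to $\mathrm{Part}$ (a query consists of representations of the coordinates of a point of $\mathfrak A$; the answer is the index of its region). -/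

import Mathlib

namespace PromiseCSP

/-! ### Machines, running time and oracles -/

/-- Programs of a machine with finitely many pushdown tapes over `{0, 1}`. Register `r` is a stack
of bits (its top is the head of the list). Every basic instruction touches the top of one stack
and costs one step, so up to constant factors this is the multitape Turing machine with a query
tape: `query r` replaces the contents `w` of register `r` by the oracle answer to `w`. -/
inductive Prog : Type
  | skip : Prog
  | push (r : ℕ) (a : Bool) : Prog
  | pop (r : ℕ) : Prog
  | query (r : ℕ) : Prog
  | seq (c d : Prog) : Prog
  /-- Branch on the top of register `r`: empty stack, top bit `0`, top bit `1`. -/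
  | test (r : ℕ) (cEmpty cZero cOne : Prog) : Prog
  /-- Repeat `c` as long as register `r` is nonempty. -/
  | loop (r : ℕ) (c : Prog) : Prog

/-- The contents of the registers. A program mentions only finitely many of them. -/
abbrev Store := ℕ → List Bool

/-- The program never consults the oracle. -/
def Prog.QueryFree : Prog → Prop
  | .skip => True
  | .push _ _ => True
  | .pop _ => True
  | .query _ => False
  | .seq c d => c.QueryFree ∧ d.QueryFree
  | .test _ c d e => c.QueryFree ∧ d.QueryFree ∧ e.QueryFree
  | .loop _ c => c.QueryFree

/-- `Exec O c s s' t`: started in the store `s`, with oracle `O`, the program `c` halts in the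
store `s'` after exactly `t` steps. -/
inductive Exec (O : List Bool → List Bool) : Prog → Store → Store → ℕ → Prop
  | skip (s : Store) : Exec O .skip s s 1
  | push (r : ℕ) (a : Bool) (s : Store) :
      Exec O (.push r a) s (Function.update s r (a :: s r)) 1
  | pop (r : ℕ) (s : Store) : Exec O (.pop r) s (Function.update s r (s r).tail) 1
  | query (r : ℕ) (s : Store) : Exec O (.query r) s (Function.update s r (O (s r))) 1
  | seq {c d : Prog} {s₁ s₂ s₃ : Store} {t u : ℕ} :
      Exec O c s₁ s₂ t → Exec O d s₂ s₃ u → Exec O (.seq c d) s₁ s₃ (t + u)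
  | test_empty {r : ℕ} {c d e : Prog} {s s' : Store} {t : ℕ} :
      s r = [] → Exec O c s s' t → Exec O (.test r c d e) s s' (t + 1)
  | test_zero {r : ℕ} {c d e : Prog} {s s' : Store} {t : ℕ} {l : List Bool} :
      s r = false :: l → Exec O d s s' t → Exec O (.test r c d e) s s' (t + 1)
  | test_one {r : ℕ} {c d e : Prog} {s s' : Store} {t : ℕ} {l : List Bool} :
      s r = true :: l → Exec O e s s' t → Exec O (.test r c d e) s s' (t + 1)
  | loop_done {r : ℕ} {c : Prog} {s : Store} : s r = [] → Exec O (.loop r c) s s 1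
  | loop_step {r : ℕ} {c : Prog} {s₁ s₂ s₃ : Store} {t u : ℕ} :
      s₁ r ≠ [] → Exec O c s₁ s₂ t → Exec O (.loop r c) s₂ s₃ u →
      Exec O (.loop r c) s₁ s₃ (t + u + 1)

/-- The initial store: the input is in register `0`, all other registers are empty. -/
def inputStore (w : List Bool) : Store := fun r => if r = 0 then w else []

/-- On input `w` the program halts after exactly `t` steps with `out` in register `0`. -/
def Computes (O : List Bool → List Bool) (c : Prog) (w out : List Bool) (t : ℕ) : Prop :=
  ∃ s' : Store, Exec O c (inputStore w) s' t ∧ s' 0 = out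

/-- `c` solves a computational problem in polynomial time: the instances `i : ι` are presented as
the bit strings `inp i`, and `R i out` says that `out` is a correct answer to the instance `i`. -/
def SolvesInPolyTime {ι : Type*} (O : List Bool → List Bool) (c : Prog)
    (inp : ι → List Bool) (R : ι → List Bool → Prop) : Prop :=
  ∃ p : Polynomial ℕ, ∀ i : ι, ∃ (out : List Bool) (t : ℕ),
    Computes O c (inp i) out t ∧ t ≤ p.eval (inp i).length ∧ R i out

/-- Solvable in polynomial time, without an oracle. -/
def PolyTimeSolvable {ι : Type*} (inp : ι → List Bool) (R : ι → List Bool → Prop) : Prop :=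
  ∃ c : Prog, c.QueryFree ∧ SolvesInPolyTime (fun _ => []) c inp R

/-- A promise language. -/
structure PromiseProblem where
  accept : Set (List Bool)
  reject : Set (List Bool)

/-- The class of the promise languages that are decided in polynomial time with oracle access to
`O`. -/
def PolyTimeClass (O : List Bool → List Bool) : Set PromiseProblem :=
  {X | ∃ c : Prog, SolvesInPolyTime O c
    (fun w : {w : List Bool // w ∈ X.accept ∪ X.reject} => w.1)
    (fun w out => (w.1 ∈ X.accept → out = [true]) ∧ (w.1 ∈ X.reject → out = [false]))}

/-! ### Encodings by bit strings -/

/-- Self-delimiting form of a bit string: each bit is preceded by a `1`, and a `0` ends it. -/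
def block : List Bool → List Bool
  | [] => [false]
  | a :: w => true :: a :: block w

/-- A finite sequence of bit strings as one bit string. -/
def encList (ws : List (List Bool)) : List Bool := ws.flatMap block

/-- Binary notation of a natural number, least significant bit first. -/
def encNat (n : ℕ) : List Bool := n.bits

/-- An integer as its sign followed by the binary notation of its absolute value. -/
def encInt (z : ℤ) : List Bool := decide (z < 0) :: encNat z.natAbs

/-- Unary notation. -/
def encUnary (n : ℕ) : List Bool := List.replicate n true

theorem block_append_inj : ∀ {v w x y : List Bool}, block v ++ x = block w ++ y → v = w ∧ x = y
  | [], [], x, y, h => by simpa [block] using h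
  | [], _ :: _, x, y, h => by simp [block] at h
  | _ :: _, [], x, y, h => by simp [block] at h
  | a :: v, a' :: w, x, y, h => by
      simp only [block, List.cons_append, List.cons.injEq, true_and] at h
      obtain ⟨h1, h2⟩ := block_append_inj h.2
      exact ⟨by rw [h.1, h1], h2⟩

theorem block_ne_nil (w : List Bool) : block w ≠ [] := by cases w <;> simp [block]

theorem encList_injective : Function.Injective encList := by
  intro u
  induction u with
  | nil =>
      intro v h
      cases v with
      | nil => rfl
      | cons b v => exact absurd h.symm (by simp [encList, block_ne_nil])
  | cons a u ih =>
      intro v h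
      cases v with
      | nil => exact absurd h (by simp [encList, block_ne_nil])
      | cons b v =>
          simp only [encList, List.flatMap_cons] at h
          obtain ⟨h1, h2⟩ := block_append_inj h
          rw [h1, ih h2]

/-! ### Promise constraint satisfaction problems -/

/-- A finite promise template over the promise domain `(D, E, φ)`: finitely many pairs of
relations `P i ⊆ D ^ ar i` and `Q i ⊆ E ^ ar i` such that `φ` is a homomorphism from the `P i` to
the `Q i`. -/
structure PromiseTemplate (D E : Type*) (φ : D → E) where
  /-- The number of relations. -/
  size : ℕ
  ar : Fin size → ℕ
  P : (i : Fin size) → Set (Fin (ar i) → D)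
  Q : (i : Fin size) → Set (Fin (ar i) → E)
  hom : ∀ i, ∀ x ∈ P i, (fun k => φ (x k)) ∈ Q i

/-- A conjunctive formula over the signature `ar`: the number of variables and the list of the
clauses, each given by a relation symbol `i` and a tuple of `ar i` variables. -/
structure Formula {s : ℕ} (ar : Fin s → ℕ) where
  numVars : ℕ
  clauses : List (Σ i : Fin s, Fin (ar i) → Fin numVars)

/-- The formula is satisfiable when its relation symbols are read as the relations `R i`. -/
def Formula.Satisfiable {s : ℕ} {ar : Fin s → ℕ} (Ψ : Formula ar) {D : Type*}
    (R : (i : Fin s) → Set (Fin (ar i) → D)) : Prop :=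
  ∃ x : Fin Ψ.numVars → D, ∀ cl ∈ Ψ.clauses, (fun k => x (cl.2 k)) ∈ R cl.1

/-- The formula as a bit string. -/
def Formula.enc {s : ℕ} {ar : Fin s → ℕ} (Ψ : Formula ar) : List Bool :=
  encList (encUnary Ψ.numVars ::
    Ψ.clauses.map fun cl =>
      encList (encNat cl.1 :: List.ofFn fun k => encNat (cl.2 k)))

namespace PromiseTemplate

variable {D E : Type*} {φ : D → E}

/-- The promise decision problem of the template: accept the formulas that are satisfiable with
the relations `P i`, reject the formulas that are not satisfiable with the relations `Q i`. -/
def PCSP (Γ : PromiseTemplate D E φ) : PromiseProblem where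
  accept := {w | ∃ Ψ : Formula Γ.ar, w = Ψ.enc ∧ Ψ.Satisfiable Γ.P}
  reject := {w | ∃ Ψ : Formula Γ.ar, w = Ψ.enc ∧ ¬ Ψ.Satisfiable Γ.Q}

/-- `f : D ^ L → E` is a polymorphism: applied coordinatewise to any `L` elements of `P i`, it
gives an element of `Q i`. -/
def IsPolymorphism (Γ : PromiseTemplate D E φ) {L : ℕ} (f : (Fin L → D) → E) : Prop :=
  0 < L ∧ ∀ i, ∀ X : Fin L → Fin (Γ.ar i) → D, (∀ l, X l ∈ Γ.P i) →
    (fun k => f fun l => X l k) ∈ Γ.Q i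

end PromiseTemplate

/-! ### LP-solvable rings -/

/-- A representation of the elements of a subring of `ℝ` by bit strings. Every element has at
least one representation, and it may have several. -/
structure RingRep (A : Subring ℝ) where
  dec : List Bool → Option A
  surj : ∀ a : A, ∃ w, dec w = some a

namespace RingRep

variable {A : Subring ℝ}

/-- The bit strings that represent an element. -/
def Code (ρ : RingRep A) : Type := {w : List Bool // (ρ.dec w).isSome}

/-- The number of bits of a representation. -/
def Code.size {ρ : RingRep A} (u : ρ.Code) : ℕ := u.1.length

/-- The element that is represented. -/
def Code.val {ρ : RingRep A} (u : ρ.Code) : A := (ρ.dec u.1).get u.2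

/-- The ring operation `op` is computed on representations in polynomial time, and the size of the
result is at most `C` times the sum of the sizes of the arguments. -/
def ComputesOp (ρ : RingRep A) (C : ℕ) (op : A → A → A) : Prop :=
  PolyTimeSolvable (fun q : ρ.Code × ρ.Code => encList [q.1.1, q.2.1])
    (fun q out => ρ.dec out = some (op q.1.val q.2.val) ∧
      out.length ≤ C * (q.1.size + q.2.size))

open Classical in
/-- The relation `rel` is decided on representations in polynomial time. -/
def DecidesRel (ρ : RingRep A) (rel : A → A → Prop) : Prop :=
  PolyTimeSolvable (fun q : ρ.Code × ρ.Code => encList [q.1.1, q.2.1])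
    (fun q out => out = [decide (rel q.1.val q.2.val)])

/-- With this representation, `A` is an efficiently computable subring of `ℝ`. -/
structure IsEfficient (ρ : RingRep A) : Prop where
  /-- A representation of an integer `n`, of size polynomial in `log (|n| + 1)`, can be computed in
  polynomial time from the binary notation of `n`. -/
  int : ∃ p : Polynomial ℕ, PolyTimeSolvable encInt
    (fun n out => ρ.dec out = some (n : A) ∧ out.length ≤ p.eval (Nat.size n.natAbs))
  /-- Positive elements are neither too large nor too small. -/
  bounds : ∃ p : Polynomial ℕ, ∀ u : ρ.Code, 0 < (u.val : ℝ) →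
    ((2 : ℝ) ^ p.eval u.size)⁻¹ < (u.val : ℝ) ∧ (u.val : ℝ) < 2 ^ p.eval u.size
  arith : ∃ C : ℕ, 0 < C ∧ ρ.ComputesOp C (fun a a' => a + a') ∧
    ρ.ComputesOp C (fun a a' => a - a') ∧ ρ.ComputesOp C (fun a a' => a * a')
  eq : ρ.DecidesRel fun a a' => a = a'
  lt : ρ.DecidesRel fun a a' => (a : ℝ) < (a' : ℝ)

end RingRep

/-- A system of linear inequalities `mat * x ≤ rhs` with integer coefficients. -/
structure LPSystem where
  numRows : ℕ
  numVars : ℕ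
  mat : Matrix (Fin numRows) (Fin numVars) ℤ
  rhs : Fin numRows → ℤ

/-- `x` satisfies all the inequalities. -/
def LPSystem.Feasible (Λ : LPSystem) (x : Fin Λ.numVars → ℝ) : Prop :=
  ∀ i, ∑ j, (Λ.mat i j : ℝ) * x j ≤ (Λ.rhs i : ℝ)

/-- The system as a bit string: the number of variables, in unary, and the rows, each of them
listing its coefficients and its right-hand side. The length of this string is, up to a constant
factor, the number of rows plus the number of variables plus the number of bits of all the
entries. -/
def LPSystem.enc (Λ : LPSystem) : List Bool :=
  encList [encUnary Λ.numVars, encList (List.ofFn fun i =>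
    encList ((List.ofFn fun j => encInt (Λ.mat i j)) ++ [encInt (Λ.rhs i)]))]

/-- With the representation `ρ`, the ring `A` is LP-solvable: it is efficiently computable, and
there is a polynomial time algorithm that outputs (representations of the coordinates of) a
solution in `A` of a given system of linear inequalities with integer coefficients, or reports
that the system has no solution in `A`. -/
def RingRep.IsLPSolvable {A : Subring ℝ} (ρ : RingRep A) : Prop :=
  ρ.IsEfficient ∧ PolyTimeSolvable LPSystem.enc (fun Λ out =>
    (∃ u : Fin Λ.numVars → ρ.Code, Λ.Feasible (fun j => ((u j).val : ℝ)) ∧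
      out = true :: encList (List.ofFn fun j => (u j).1)) ∨
    ((¬ ∃ x : Fin Λ.numVars → A, Λ.Feasible fun j => (x j : ℝ)) ∧ out = [false]))

/-! ### Open partitions and regional-periodic polymorphisms -/

section Regions

variable {b : ℕ}

/-- The set `(A_1 × ⋯ × A_b) ∩ [0, 1]^b`. -/
def cube (A : Fin b → Subring ℝ) : Set (Fin b → ℝ) :=
  {x | ∀ j, x j ∈ A j ∧ 0 ≤ x j ∧ x j ≤ 1}

/-- `Part` is an open partition: all its fibres are relatively open. -/
def IsOpenPartition {A : Fin b → Subring ℝ} {S : Type*} (Part : cube A → S) : Prop :=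
  ∀ x : cube A, ∃ ε > 0, ∀ y : cube A, dist (y : Fin b → ℝ) x < ε → Part y = Part x

open Classical in
/-- The extension of an open partition to points `x` of `[0, 1]^b` outside of `cube A`: its value
is `k` if `Part` is constantly `k` near `x`, and it is undefined (`none`) if there is no such
`k`. -/
noncomputable def extPart {A : Fin b → Subring ℝ} {S : Type*} (Part : cube A → S)
    (x : Fin b → ℝ) : Option S :=
  if h : ∃ k : S, ∃ ε > 0, ∀ y : cube A, dist x (y : Fin b → ℝ) < ε → Part y = k then
    some h.choose
  else none

/-- A partition `(B_1, …, B_b)` of the coordinates is given by the map `blk` that sends each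
coordinate to the index of its block. This is the size of the block `B_j`. -/
def blockSize {L : ℕ} (blk : Fin L → Fin b) (j : Fin b) : ℕ :=
  (Finset.univ.filter fun l => blk l = j).card

/-- The Hamming weight of `x` in the block `B_j`. -/
def ham {L : ℕ} (blk : Fin L → Fin b) (x : Fin L → Bool) (j : Fin b) : ℕ :=
  (Finset.univ.filter fun l => blk l = j ∧ x l = true).card

theorem ham_le {L : ℕ} (blk : Fin L → Fin b) (x : Fin L → Bool) (j : Fin b) :
    ham blk x j ≤ blockSize blk j :=
  Finset.card_le_card fun l hl => by
    simp only [Finset.mem_filter, Finset.mem_univ, true_and] at hl ⊢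
    exact hl.1

/-- The blocks are nonempty, and the extended partition is defined at all the points
`(c_1 / |B_1|, …, c_b / |B_b|)` with `c_j ∈ {0, …, |B_j|}`. -/
structure Admissible {A : Fin b → Subring ℝ} {S : Type*} (Part : cube A → S) {L : ℕ}
    (blk : Fin L → Fin b) : Prop where
  pos : ∀ j, 0 < blockSize blk j
  defined : ∀ c : Fin b → ℕ, (∀ j, c j ≤ blockSize blk j) →
    (extPart Part fun j => (c j : ℝ) / (blockSize blk j : ℝ)).isSome

/-- The regional-periodic function: `M_k` of the vector of the block Hamming weights modulo `J_k`,
where `k` is the region of the vector of the relative block Hamming weights. -/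
noncomputable def regPer {A : Fin b → Subring ℝ} {S E : Type*} (Part : cube A → S)
    (J : S → Ideal (Fin b → ℤ)) (M : (k : S) → ((Fin b → ℤ) ⧸ J k) → E)
    {L : ℕ} (blk : Fin L → Fin b) (hblk : Admissible Part blk) (x : Fin L → Bool) : E :=
  let k : S := (extPart Part fun j => (ham blk x j : ℝ) / (blockSize blk j : ℝ)).get
    (hblk.defined (ham blk x) (ham_le blk x))
  M k (Ideal.Quotient.mk (J k) fun j => (ham blk x j : ℤ))

open Classical in
/-- The oracle for `Part`: a query consists of representations of the coordinates of a point of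
`cube A`, and the answer is the index of its region. The answer to all other bit strings is the
default index `0`. -/
noncomputable def partOracle {A : Fin b → Subring ℝ} (ρ : (j : Fin b) → RingRep (A j)) {s : ℕ}
    (Part : cube A → Fin s) (w : List Bool) : List Bool :=
  if h : ∃ x : cube A, ∃ u : (j : Fin b) → (ρ j).Code,
      (∀ j, ((u j).val : ℝ) = x.1 j) ∧ w = encList (List.ofFn fun j => (u j).1) then
    encNat (Part h.choose)
  else encNat 0

/-- The answers of the oracle do not depend on a choice. -/
theorem partOracle_query {A : Fin b → Subring ℝ} (ρ : (j : Fin b) → RingRep (A j)) {s : ℕ}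
    (Part : cube A → Fin s) (x : cube A) (u : (j : Fin b) → (ρ j).Code)
    (hu : ∀ j, ((u j).val : ℝ) = x.1 j) :
    partOracle ρ Part (encList (List.ofFn fun j => (u j).1)) = encNat (Part x) := by
  have h : ∃ x : cube A, ∃ u' : (j : Fin b) → (ρ j).Code, (∀ j, ((u' j).val : ℝ) = x.1 j) ∧
      encList (List.ofFn fun j => (u j).1) = encList (List.ofFn fun j => (u' j).1) :=
    ⟨x, u, hu, rfl⟩
  rw [partOracle, dif_pos h]
  obtain ⟨u', hu', he⟩ := h.choose_spec
  have he' := List.ofFn_injective (encList_injective he)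
  have : h.choose = x := by
    apply Subtype.ext
    funext j
    rw [← hu', ← hu]
    have : u j = u' j := Subtype.ext (congrFun he' j)
    rw [this]
  rw [this]

end Regions

end PromiseCSP

open PromiseCSP

open PromiseCSP

namespace PromiseCSP

/-! ### Reasoning about programs -/

/-! The algorithm solves one relaxation in several rings. For each clause, introduce a weight for
every tuple of the relation `P i`; the weights sum to `1`, and their marginal at each position
equals the unknown attached to the variable there. This system is solved with nonnegative weights in
every `A j`, and without sign conditions modulo one fixed `m` such that `m ℤ^b` lies in all ideals
`J k`. The algorithm accepts exactly if all these systems are solvable.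

Completeness: the indicator of the tuple chosen by a satisfying assignment is a solution in every
ring (`accepts_of_satisfiable`).

Soundness (`satisfiable_of_weights`): the solutions give each variable `v` a point `x v` of the cube
and a residue `ρ v`. By openness, `Part` is constant near each of the finitely many `x v`. Take a
polymorphism whose blocks are large compared with these radii. In a block of size `n`, the real
weights times `n` are rounded to tuple counts with sum `n` that are congruent modulo `m` to `n`
times the modular weights; the error is bounded independently of `n` (`exists_counts`). Tuples with
these counts are distributed over the block (`exists_assignment`), and the polymorphism is applied.
At a position holding `v`, the relative Hamming weights are close to `x v`, so the region is `Part
(x v)` (`extPart_eq_some`), and the Hamming weights modulo `m` are the block sizes times `ρ v`. The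
output therefore depends on `v` alone, not on the clause, and these outputs satisfy all the `Q i`.

Regions and polymorphisms occur only in this analysis, so the program makes no query. Its running
time rests on the given LP algorithms and on an elimination over `ZMod m` (`eliminate_spec`), whose
arithmetic is a finite table because `m` is fixed. A calculus of polynomial-time functions (`PF`),
closed under composition, case distinction and size-bounded folds, turns this description into a
program. -/

theorem Exec.of_queryFree {O O' : List Bool → List Bool} {c : Prog} {s s' : Store} {t : ℕ}
    (h : Exec O c s s' t) (hc : c.QueryFree) : Exec O' c s s' t := by
  induction h with
  | skip s => exact .skip s
  | push r a s => exact .push r a s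
  | pop r s => exact .pop r s
  | query r s => exact hc.elim
  | seq _ _ ih₁ ih₂ => exact .seq (ih₁ hc.1) (ih₂ hc.2)
  | test_empty h _ ih => exact .test_empty h (ih hc.1)
  | test_zero h _ ih => exact .test_zero h (ih hc.2.1)
  | test_one h _ ih => exact .test_one h (ih hc.2.2)
  | loop_done h => exact .loop_done h
  | loop_step h _ _ ih₁ ih₂ => exact .loop_step h (ih₁ hc) (ih₂ hc)

/-- A step lengthens a register by at most one bit. Only a query, whose answer may be arbitrarily
long, could violate this. -/
theorem Exec.length_le {O : List Bool → List Bool} {c : Prog} {s s' : Store} {t : ℕ}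
    (h : Exec O c s s' t) (hc : c.QueryFree) (q : ℕ) : (s' q).length ≤ (s q).length + t := by
  induction h with
  | skip s => simp
  | push r a s =>
      by_cases hq : q = r
      · subst hq; simp
      · simp [Function.update_of_ne hq]
  | pop r s =>
      by_cases hq : q = r
      · subst hq; simp; omega
      · simp [Function.update_of_ne hq]
  | query r s => exact hc.elim
  | seq _ _ ih₁ ih₂ => have := ih₁ hc.1; have := ih₂ hc.2; omega
  | test_empty h _ ih => have := ih hc.1; omega
  | test_zero h _ ih => have := ih hc.2.1; omega
  | test_one h _ ih => have := ih hc.2.2; omega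
  | loop_done h => simp
  | loop_step h _ _ ih₁ ih₂ => have := ih₁ hc; have := ih₂ hc; omega

/-- A strict upper bound for the registers of a program. -/
def Prog.bound : Prog → ℕ
  | .skip => 0
  | .push r _ => r + 1
  | .pop r => r + 1
  | .query r => r + 1
  | .seq c d => max c.bound d.bound
  | .test r c d e => max (r + 1) (max c.bound (max d.bound e.bound))
  | .loop r c => max (r + 1) c.bound

theorem Exec.eq_of_bound_le {O : List Bool → List Bool} {c : Prog} {s s' : Store} {t : ℕ}
    (h : Exec O c s s' t) {q : ℕ} (hq : c.bound ≤ q) : s' q = s q := by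
  induction h with
  | skip s => rfl
  | push r a s | pop r s | query r s =>
      exact Function.update_of_ne (by simp only [Prog.bound] at hq; omega) _ _
  | seq _ _ ih₁ ih₂ =>
      simp only [Prog.bound, max_le_iff] at hq
      rw [ih₂ hq.2, ih₁ hq.1]
  | test_empty h _ ih | test_zero h _ ih | test_one h _ ih =>
      simp only [Prog.bound, max_le_iff] at hq
      exact ih (by tauto)
  | loop_done h => rfl
  | loop_step h _ _ ih₁ ih₂ =>
      rw [ih₂ hq, ih₁ (by simp only [Prog.bound, max_le_iff] at hq; exact hq.2)]

/-- Renaming of the registers. -/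
def Prog.rename (g : ℕ → ℕ) : Prog → Prog
  | .skip => .skip
  | .push r a => .push (g r) a
  | .pop r => .pop (g r)
  | .query r => .query (g r)
  | .seq c d => .seq (c.rename g) (d.rename g)
  | .test r c d e => .test (g r) (c.rename g) (d.rename g) (e.rename g)
  | .loop r c => .loop (g r) (c.rename g)

theorem Prog.QueryFree.rename {g : ℕ → ℕ} {c : Prog} (h : c.QueryFree) :
    (c.rename g).QueryFree := by
  induction c with
  | skip | push | pop => trivial
  | query => exact h
  | seq c d ihc ihd => exact ⟨ihc h.1, ihd h.2⟩
  | test r c d e ihc ihd ihe => exact ⟨ihc h.1, ihd h.2.1, ihe h.2.2⟩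
  | loop r c ih => exact ih h

/-- Injectivity keeps distinct registers distinct, so the renamed run simulates the original one.
Registers outside the range of `g` are free to hold other data. -/
theorem Exec.rename {O : List Bool → List Bool} {g : ℕ → ℕ} (hg : Function.Injective g)
    {c : Prog} {s s' : Store} {t : ℕ} (h : Exec O c s s' t) :
    ∀ S : Store, (∀ r, S (g r) = s r) → ∃ S' : Store, Exec O (c.rename g) S S' t ∧
      (∀ r, S' (g r) = s' r) ∧ ∀ q, q ∉ Set.range g → S' q = S q := by
  -- Updating one register commutes with the renaming; this settles push, pop and query at once.
  have key : ∀ (S s : Store) (r : ℕ) (v : List Bool), (∀ r, S (g r) = s r) →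
      (∀ q, Function.update S (g r) v (g q) = Function.update s r v q) ∧
      ∀ q, q ∉ Set.range g → Function.update S (g r) v q = S q := by
    refine fun S s r v hS => ⟨fun q => ?_, fun q hq => ?_⟩
    · by_cases hq : q = r
      · subst hq; simp
      · rw [Function.update_of_ne (fun h => hq (hg h)), Function.update_of_ne hq, hS]
    · exact Function.update_of_ne (fun h => hq ⟨r, h.symm⟩) _ _
  induction h with
  | skip s => exact fun S hS => ⟨S, .skip S, hS, fun _ _ => rfl⟩
  | push r a s =>
      intro S hS
      exact ⟨_, by simpa [Prog.rename, hS] using Exec.push (O := O) (g r) a S, key S s r _ hS⟩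
  | pop r s =>
      intro S hS
      exact ⟨_, by simpa [Prog.rename, hS] using Exec.pop (O := O) (g r) S, key S s r _ hS⟩
  | query r s =>
      intro S hS
      exact ⟨_, by simpa [Prog.rename, hS] using Exec.query (O := O) (g r) S, key S s r _ hS⟩
  | seq _ _ ih₁ ih₂ =>
      intro S hS
      obtain ⟨S₁, e₁, h₁, h₁'⟩ := ih₁ S hS
      obtain ⟨S₂, e₂, h₂, h₂'⟩ := ih₂ S₁ h₁
      exact ⟨S₂, .seq e₁ e₂, h₂, fun q hq => (h₂' q hq).trans (h₁' q hq)⟩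
  | test_empty h _ ih =>
      intro S hS
      obtain ⟨S₁, e₁, h₁⟩ := ih S hS
      exact ⟨S₁, .test_empty ((hS _).trans h) e₁, h₁⟩
  | test_zero h _ ih =>
      intro S hS
      obtain ⟨S₁, e₁, h₁⟩ := ih S hS
      exact ⟨S₁, .test_zero ((hS _).trans h) e₁, h₁⟩
  | test_one h _ ih =>
      intro S hS
      obtain ⟨S₁, e₁, h₁⟩ := ih S hS
      exact ⟨S₁, .test_one ((hS _).trans h) e₁, h₁⟩
  | loop_done h => exact fun S hS => ⟨S, .loop_done ((hS _).trans h), hS, fun _ _ => rfl⟩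
  | loop_step h _ _ ih₁ ih₂ =>
      intro S hS
      obtain ⟨S₁, e₁, h₁, h₁'⟩ := ih₁ S hS
      obtain ⟨S₂, e₂, h₂, h₂'⟩ := ih₂ S₁ h₁
      exact ⟨S₂, .loop_step (by rwa [hS]) e₁ e₂, h₂, fun q hq => (h₂' q hq).trans (h₁' q hq)⟩

/-- Without an oracle, the program `c` leads from `s` to `s'` in at most `T` steps. -/
def Reach (c : Prog) (s s' : Store) (T : ℕ) : Prop :=
  ∃ t ≤ T, Exec (fun _ => []) c s s' t

namespace Reach

theorem mono {c : Prog} {s s' : Store} {T U : ℕ} (h : Reach c s s' T) (hU : T ≤ U) :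
    Reach c s s' U := by
  obtain ⟨t, ht, e⟩ := h
  exact ⟨t, ht.trans hU, e⟩

theorem seq {c d : Prog} {s₁ s₂ s₃ : Store} {T U : ℕ} (h₁ : Reach c s₁ s₂ T)
    (h₂ : Reach d s₂ s₃ U) : Reach (.seq c d) s₁ s₃ (T + U) := by
  obtain ⟨t, ht, e⟩ := h₁
  obtain ⟨u, hu, e'⟩ := h₂
  exact ⟨t + u, by omega, .seq e e'⟩

theorem push (r : ℕ) (a : Bool) (s : Store) :
    Reach (.push r a) s (Function.update s r (a :: s r)) 1 := ⟨1, le_rfl, .push r a s⟩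

theorem pop (r : ℕ) (s : Store) :
    Reach (.pop r) s (Function.update s r (s r).tail) 1 := ⟨1, le_rfl, .pop r s⟩

theorem test_empty {r : ℕ} {c d e : Prog} {s s' : Store} {T : ℕ} (hr : s r = [])
    (h : Reach c s s' T) : Reach (.test r c d e) s s' (T + 1) := by
  obtain ⟨t, ht, x⟩ := h
  exact ⟨t + 1, by omega, .test_empty hr x⟩

theorem test_zero {r : ℕ} {c d e : Prog} {s s' : Store} {T : ℕ} {l : List Bool}
    (hr : s r = false :: l) (h : Reach d s s' T) : Reach (.test r c d e) s s' (T + 1) := by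
  obtain ⟨t, ht, x⟩ := h
  exact ⟨t + 1, by omega, .test_zero hr x⟩

theorem test_one {r : ℕ} {c d e : Prog} {s s' : Store} {T : ℕ} {l : List Bool}
    (hr : s r = true :: l) (h : Reach e s s' T) : Reach (.test r c d e) s s' (T + 1) := by
  obtain ⟨t, ht, x⟩ := h
  exact ⟨t + 1, by omega, .test_one hr x⟩

theorem loop_done {r : ℕ} {c : Prog} {s : Store} (hr : s r = []) : Reach (.loop r c) s s 1 :=
  ⟨1, le_rfl, .loop_done hr⟩

theorem loop_step {r : ℕ} {c : Prog} {s₁ s₂ s₃ : Store} {T U : ℕ} (hr : s₁ r ≠ [])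
    (h₁ : Reach c s₁ s₂ T) (h₂ : Reach (.loop r c) s₂ s₃ U) :
    Reach (.loop r c) s₁ s₃ (T + U + 1) := by
  obtain ⟨t, ht, e⟩ := h₁
  obtain ⟨u, hu, e'⟩ := h₂
  exact ⟨t + u + 1, by omega, .loop_step hr e e'⟩

end Reach

/-- The store with given contents of the registers `0`, `1`, `2`, `3`. -/
def regs (x₀ x₁ x₂ x₃ : List Bool) : Store
  | 0 => x₀
  | 1 => x₁
  | 2 => x₂
  | 3 => x₃
  | _ + 4 => []

section regs
variable (x₀ x₁ x₂ x₃ y : List Bool)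

@[simp] theorem regs_zero : regs x₀ x₁ x₂ x₃ 0 = x₀ := rfl
@[simp] theorem regs_one : regs x₀ x₁ x₂ x₃ 1 = x₁ := rfl
@[simp] theorem regs_two : regs x₀ x₁ x₂ x₃ 2 = x₂ := rfl
@[simp] theorem regs_three : regs x₀ x₁ x₂ x₃ 3 = x₃ := rfl

@[simp] theorem update_regs_zero :
    Function.update (regs x₀ x₁ x₂ x₃) 0 y = regs y x₁ x₂ x₃ := by
  funext r; rcases r with _ | _ | _ | _ | r <;> simp [regs]
@[simp] theorem update_regs_one :
    Function.update (regs x₀ x₁ x₂ x₃) 1 y = regs x₀ y x₂ x₃ := by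
  funext r; rcases r with _ | _ | _ | _ | r <;> simp [regs]
@[simp] theorem update_regs_two :
    Function.update (regs x₀ x₁ x₂ x₃) 2 y = regs x₀ x₁ y x₃ := by
  funext r; rcases r with _ | _ | _ | _ | r <;> simp [regs]
@[simp] theorem update_regs_three :
    Function.update (regs x₀ x₁ x₂ x₃) 3 y = regs x₀ x₁ x₂ y := by
  funext r; rcases r with _ | _ | _ | _ | r <;> simp [regs]

theorem inputStore_eq_regs (w : List Bool) : inputStore w = regs w [] [] [] := by
  funext r; rcases r with _ | _ | _ | _ | r <;> simp [inputStore, regs]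

end regs

/-! ### Subroutines for clearing, moving, copying, packing and unpacking registers. -/

namespace Prog

/-- Empty register `r`. -/
def clear (r : ℕ) : Prog := .loop r (.pop r)

/-- Take the bits off register `r` one by one, and run `acts a` for each bit `a`. -/
def drain (r : ℕ) (acts : Bool → Prog) : Prog :=
  .loop r (.test r .skip (.seq (.pop r) (acts false)) (.seq (.pop r) (acts true)))

/-- Empty register `r` onto register `q`. -/
def move (r q : ℕ) : Prog := drain r (.push q)

/-- Append a copy of register `0` to register `1`. -/
def dup : Prog := .seq (move 0 2) (drain 2 fun a => .seq (.push 0 a) (.push 1 a))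

/-- Prepend the self-delimiting form of the reversal of register `2` to register `0`. -/
def pack : Prog := .seq (.push 0 false) (drain 2 fun a => .seq (.push 0 a) (.push 0 true))

/-- Move a self-delimiting string from register `0` to register `1`, in reversed order. -/
def unpack : Prog :=
  .seq (.push 3 true) (.loop 3 (.test 0 .skip (.seq (.pop 0) (.pop 3))
    (.seq (.pop 0) (.test 0 .skip (.seq (.pop 0) (.push 1 false))
      (.seq (.pop 0) (.push 1 true))))))

/-- Replace register `0` by register `1`. -/
def restore : Prog := .seq (clear 0) (.seq (move 1 2) (move 2 0))

theorem queryFree_drain {r : ℕ} {acts : Bool → Prog} (h : ∀ a, (acts a).QueryFree) :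
    (drain r acts).QueryFree := ⟨trivial, ⟨trivial, h _⟩, ⟨trivial, h _⟩⟩

theorem queryFree_move (r q : ℕ) : (move r q).QueryFree := queryFree_drain fun _ => trivial

theorem queryFree_clear (r : ℕ) : (clear r).QueryFree := trivial

theorem queryFree_dup : dup.QueryFree :=
  ⟨queryFree_move _ _, queryFree_drain fun _ => ⟨trivial, trivial⟩⟩

theorem queryFree_pack : pack.QueryFree := ⟨trivial, queryFree_drain fun _ => ⟨trivial, trivial⟩⟩

theorem queryFree_unpack : unpack.QueryFree := by simp [unpack, QueryFree]

theorem queryFree_restore : restore.QueryFree :=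
  ⟨queryFree_clear _, queryFree_move _ _, queryFree_move _ _⟩

end Prog

namespace Reach

theorem clear (r : ℕ) (s : Store) :
    Reach (.clear r) s (Function.update s r []) (2 * (s r).length + 1) := by
  generalize hw : s r = w
  induction w generalizing s with
  | nil =>
      have : Function.update s r [] = s := by rw [← hw]; simp
      rw [this]
      exact loop_done hw
  | cons a w ih =>
      have h := ih (Function.update s r w) (by simp)
      rw [Function.update_idem] at h
      have h₁ := pop r s
      rw [hw] at h₁
      exact (loop_step (by simp [hw]) h₁ h).mono (by simp; omega)

theorem drain_nil {r : ℕ} {acts : Bool → Prog} {s : Store} (hr : s r = []) :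
    Reach (.drain r acts) s s 1 := loop_done hr

theorem drain_cons {r : ℕ} {acts : Bool → Prog} {s s₁ s₂ : Store} {a : Bool} {w : List Bool}
    {T U : ℕ} (hr : s r = a :: w) (h : Reach (acts a) (Function.update s r w) s₁ T)
    (h' : Reach (.drain r acts) s₁ s₂ U) : Reach (.drain r acts) s s₂ (T + U + 3) := by
  have hp := pop r s
  rw [hr, List.tail_cons] at hp
  refine (loop_step (U := U) (T := T + 2) (s₂ := s₁) (by simp [hr]) ?_ h').mono (by omega)
  cases a
  · exact (test_zero hr (hp.seq h)).mono (by omega)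
  · exact (test_one hr (hp.seq h)).mono (by omega)

theorem move {r q : ℕ} (hrq : r ≠ q) (s : Store) :
    Reach (.move r q) s (Function.update (Function.update s r []) q ((s r).reverse ++ s q))
      (4 * (s r).length + 1) := by
  generalize hw : s r = w
  induction w generalizing s with
  | nil =>
      have : Function.update (Function.update s r []) q (([] : List Bool).reverse ++ s q) = s := by
        have : Function.update s r [] = s := by rw [← hw]; simp
        rw [this]; simp
      rw [this]
      exact drain_nil hw
  | cons a w ih =>
      have h := ih (Function.update (Function.update s r w) q (a :: s q)) (by
        rw [Function.update_of_ne hrq]; simp)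
      have h₁ := push q a (Function.update s r w)
      rw [Function.update_of_ne hrq.symm] at h₁
      have h₂ := (drain_cons hw h₁ h).mono (U := 4 * (a :: w).length + 1)
        (by rw [List.length_cons]; omega)
      convert h₂ using 1
      · rfl
      funext z
      by_cases hz : z = q
      · subst hz; simp
      · by_cases hz' : z = r
        · subst hz'; simp [hrq]
        · simp [hz, hz']

theorem dup (w : List Bool) :
    Reach .dup (regs w [] [] []) (regs w w [] []) (9 * w.length + 2) := by
  have h : ∀ w x y : List Bool, Reach (.drain 2 fun a => .seq (.push 0 a) (.push 1 a))
      (regs x y w []) (regs (w.reverse ++ x) (w.reverse ++ y) [] []) (5 * w.length + 1) := by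
    intro w
    induction w with
    | nil => exact fun x y => drain_nil rfl
    | cons a w ih =>
        intro x y
        have h₁ := (push 0 a (regs x y w [])).seq (push 1 a _)
        simp only [regs_zero, update_regs_zero, regs_one, update_regs_one] at h₁
        have h₂ := drain_cons (s := regs x y (a :: w) []) (r := 2)
          (acts := fun a => .seq (.push 0 a) (.push 1 a)) rfl
          (by simpa using h₁) (ih (a :: x) (a :: y))
        simpa using h₂.mono (U := 5 * (w.length + 1) + 1) (by omega)
  have h₁ := (move (r := 0) (q := 2) (by decide) (regs w [] [] [])).seq
    (by simpa using h w.reverse [] [])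
  exact h₁.mono (by simp; omega)

/-- A block has to be stacked from its end: first the terminator, then the bits from last to first,
which is the order in which the reversed copy in register `2` yields them. -/
theorem pack (w x y : List Bool) :
    Reach .pack (regs y x w.reverse []) (regs (block w ++ y) x [] []) (5 * w.length + 2) := by
  have h : ∀ w u : List Bool, Reach (.drain 2 fun a => .seq (.push 0 a) (.push 0 true))
      (regs (block u ++ y) x w []) (regs (block (w.reverse ++ u) ++ y) x [] [])
      (5 * w.length + 1) := by
    intro w
    induction w with
    | nil => exact fun u => drain_nil rfl
    | cons a w ih =>
        intro u
        have h₁ := (push 0 a (regs (block u ++ y) x w [])).seq (push 0 true _)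
        simp only [regs_zero, update_regs_zero] at h₁
        have h₂ := drain_cons (s := regs (block u ++ y) x (a :: w) []) (r := 2)
          (acts := fun a => .seq (.push 0 a) (.push 0 true)) rfl
          (by simpa [block] using h₁) (ih (a :: u))
        simpa using h₂.mono (U := 5 * (w.length + 1) + 1) (by omega)
  have h₁ := (push 0 false (regs y x w.reverse [])).seq (by simpa [block] using h w.reverse [])
  exact h₁.mono (by omega)

theorem unpack (w y : List Bool) :
    Reach .unpack (regs (block w ++ y) [] [] []) (regs y w.reverse [] [])
      (6 * w.length + 6) := by
  -- Register `3` holds a single bit as a flag; reading the terminator pops it and so ends the loop.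
  have h : ∀ w u : List Bool, Reach (.loop 3 (.test 0 .skip (.seq (.pop 0) (.pop 3))
    (.seq (.pop 0) (.test 0 .skip (.seq (.pop 0) (.push 1 false))
      (.seq (.pop 0) (.push 1 true)))))) (regs (block w ++ y) u [] [true])
      (regs y (w.reverse ++ u) [] []) (6 * w.length + 5) := by
    intro w
    induction w with
    | nil =>
        intro u
        have h₁ := (pop 0 (regs (block [] ++ y) u [] [true])).seq (pop 3 _)
        simp only [block, regs_zero, update_regs_zero, regs_three, update_regs_three,
          List.singleton_append, List.tail_cons] at h₁
        exact (loop_step (by simp) (test_zero (l := y) rfl h₁) (loop_done rfl)).mono (by simp)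
    | cons a w ih =>
        intro u
        have h₁ := pop 0 (regs (block (a :: w) ++ y) u [] [true])
        have h₂ := (pop 0 (regs (a :: (block w ++ y)) u [] [true])).seq (push 1 a _)
        simp only [block, regs_zero, update_regs_zero, regs_one, update_regs_one,
          List.cons_append, List.tail_cons] at h₁ h₂
        have h₃ : Reach (.test 0 .skip (.seq (.pop 0) (.push 1 false))
            (.seq (.pop 0) (.push 1 true))) (regs (a :: (block w ++ y)) u [] [true])
            (regs (block w ++ y) (a :: u) [] [true]) 3 := by
          cases a
          · exact test_zero rfl h₂
          · exact test_one rfl h₂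
        have h₄ := loop_step (by simp)
          (test_one (c := .skip) (d := .seq (.pop 0) (.pop 3)) (l := a :: (block w ++ y)) rfl
          (h₁.seq h₃)) (ih (a :: u))
        simpa [block] using h₄.mono (U := 6 * (w.length + 1) + 5) (by omega)
  have h₁ := (push 3 true (regs (block w ++ y) [] [] [])).seq (by simpa using h w [])
  exact h₁.mono (by omega)

theorem restore (x y : List Bool) :
    Reach .restore (regs x y [] []) (regs y [] [] []) (2 * x.length + 8 * y.length + 3) := by
  have h₁ := (clear 0 (regs x y [] [])).seq ((move (r := 1) (q := 2) (by decide) _).seq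
    (move (r := 2) (q := 0) (by decide) _))
  simp at h₁
  exact h₁.mono (by omega)

end Reach

/-! ### Polynomial time maps between families of bit strings -/

/-- Monotonicity holds because the coefficients are natural numbers. It allows time bounds to be
composed with bounds on intermediate lengths. -/
theorem Polynomial.eval_mono_nat (p : Polynomial ℕ) {m n : ℕ} (h : m ≤ n) :
    p.eval m ≤ p.eval n := by
  induction p using Polynomial.induction_on' with
  | add p q hp hq => simp only [Polynomial.eval_add]; omega
  | monomial k a => simp only [Polynomial.eval_monomial]; gcongr

/-- A query-free program transforms the strings `inp i` into the strings `out i` in polynomial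
time, leaving all other registers empty. -/
def Poly {ι : Type*} (inp out : ι → List Bool) : Prop :=
  ∃ c : Prog, c.QueryFree ∧ ∃ p : Polynomial ℕ, ∀ i,
    Reach c (inputStore (inp i)) (inputStore (out i)) (p.eval (inp i).length)

/-- The renaming of registers that makes the registers `1`, `2`, `3` available. -/
def frameMap (r : ℕ) : ℕ := if r = 0 then 0 else r + 3

theorem frameMap_injective : Function.Injective frameMap := by
  intro a b h
  simp only [frameMap] at h
  split_ifs at h <;> omega

/-- `frameMap` fixes register `0` and sends the work registers to `4, 5, …`, so data parked in `1`,
`2`, `3` survive the run. -/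
theorem Reach.frame {c : Prog} {x y : List Bool} {T : ℕ}
    (h : Reach c (inputStore x) (inputStore y) T) (x₁ x₂ x₃ : List Bool) :
    Reach (c.rename frameMap) (regs x x₁ x₂ x₃) (regs y x₁ x₂ x₃) T := by
  obtain ⟨t, ht, e⟩ := h
  obtain ⟨S, e', h₁, h₂⟩ := e.rename frameMap_injective (regs x x₁ x₂ x₃) (by
    rintro (_ | r) <;> simp [frameMap, inputStore, regs])
  refine ⟨t, ht, ?_⟩
  convert e'
  funext q
  rcases q with _ | _ | _ | _ | q
  · simpa [frameMap, inputStore] using (h₁ 0).symm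
  · exact (h₂ 1 (by rintro ⟨r, hr⟩; simp only [frameMap] at hr; split_ifs at hr; omega)).symm
  · exact (h₂ 2 (by rintro ⟨r, hr⟩; simp only [frameMap] at hr; split_ifs at hr; omega)).symm
  · exact (h₂ 3 (by rintro ⟨r, hr⟩; simp only [frameMap] at hr; split_ifs at hr; omega)).symm
  · simpa [frameMap, inputStore, regs] using (h₁ (q + 1)).symm

namespace Poly

variable {ι κ : Type*} {inp mid out : ι → List Bool}

theorem frame (h : Poly inp out) : ∃ c : Prog, c.QueryFree ∧ ∃ p : Polynomial ℕ, ∀ i x₁ x₂ x₃,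
    Reach c (regs (inp i) x₁ x₂ x₃) (regs (out i) x₁ x₂ x₃) (p.eval (inp i).length) := by
  obtain ⟨c, hc, p, hp⟩ := h
  exact ⟨_, hc.rename, p, fun i => (hp i).frame⟩

theorem of_regs {c : Prog} (hc : c.QueryFree) (p : Polynomial ℕ)
    (h : ∀ i, Reach c (regs (inp i) [] [] []) (regs (out i) [] [] []) (p.eval (inp i).length)) :
    Poly inp out := ⟨c, hc, p, fun i => by simpa [inputStore_eq_regs] using h i⟩

theorem length_le (h : Poly inp out) :
    ∃ p : Polynomial ℕ, ∀ i, (out i).length ≤ p.eval (inp i).length := by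
  obtain ⟨c, hc, p, hp⟩ := h
  refine ⟨.X + p, fun i => ?_⟩
  obtain ⟨t, ht, e⟩ := hp i
  have := e.length_le hc 0
  simp only [inputStore, if_pos] at this
  simp only [Polynomial.eval_add, Polynomial.eval_X]
  omega

theorem reindex (h : Poly inp out) (g : κ → ι) : Poly (fun k => inp (g k)) (fun k => out (g k)) := by
  obtain ⟨c, hc, p, hp⟩ := h
  exact ⟨c, hc, p, fun k => hp (g k)⟩

theorem congr {out' : ι → List Bool} (h : Poly inp out) (ho : ∀ i, out i = out' i) :
    Poly inp out' := by
  rwa [← funext ho]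

theorem refl (inp : ι → List Bool) : Poly inp inp :=
  ⟨.skip, trivial, 1, fun i => ⟨1, by simp, .skip _⟩⟩

theorem trans (h₁ : Poly inp mid) (h₂ : Poly mid out) : Poly inp out := by
  obtain ⟨q, hq⟩ := h₁.length_le
  obtain ⟨c, hc, p, hp⟩ := h₁
  obtain ⟨d, hd, r, hr⟩ := h₂
  refine ⟨.seq c d, ⟨hc, hd⟩, p + r.comp q, fun i => ((hp i).seq (hr i)).mono ?_⟩
  simp only [Polynomial.eval_add, Polynomial.eval_comp]
  have := r.eval_mono_nat (hq i)
  omega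

theorem nil (inp : ι → List Bool) : Poly inp fun _ => [] :=
  of_regs (Prog.queryFree_clear 0) (2 * .X + 1) fun i => by
    simpa using Reach.clear 0 (regs (inp i) [] [] [])

theorem cons (a : Bool) (h : Poly inp out) : Poly inp fun i => a :: out i :=
  h.trans <| of_regs (c := .push 0 a) trivial 1 fun i => by
    simpa using Reach.push 0 a (regs (out i) [] [] [])

theorem tail (h : Poly inp out) : Poly inp fun i => (out i).tail :=
  h.trans <| of_regs (c := .pop 0) trivial 1 fun i => by
    simpa using Reach.pop 0 (regs (out i) [] [] [])

theorem const (inp : ι → List Bool) (w : List Bool) : Poly inp fun _ => w := by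
  induction w with
  | nil => exact nil inp
  | cons a w ih => exact ih.cons a

theorem pair {out₁ out₂ : ι → List Bool} (h₁ : Poly inp out₁) (h₂ : Poly inp out₂) :
    Poly inp fun i => block (out₁ i) ++ out₂ i := by
  obtain ⟨q, hq⟩ := h₁.length_le
  obtain ⟨c, hc, p, hp⟩ := h₁.frame
  obtain ⟨d, hd, r, hr⟩ := h₂.frame
  -- The copy of the input waits in register `1` while `c` runs. The first output is then parked,
  -- reversed, in register `2`, as `pack` expects it, and the copy travels through register `3` so
  -- that two reversals restore its order before `d` runs.
  refine of_regs (c := .seq .dup (.seq c (.seq (.move 0 2) (.seq (.move 1 3) (.seq (.move 3 0)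
    (.seq d .pack))))))
    ⟨Prog.queryFree_dup, hc, Prog.queryFree_move _ _, Prog.queryFree_move _ _,
      Prog.queryFree_move _ _, hd, Prog.queryFree_pack⟩
    (17 * .X + 7 + p + r + 9 * q) fun i => ?_
  have m₁ := Reach.move (r := 0) (q := 2) (by decide) (regs (out₁ i) (inp i) [] [])
  have m₂ := Reach.move (r := 1) (q := 3) (by decide) (regs [] (inp i) (out₁ i).reverse [])
  have m₃ := Reach.move (r := 3) (q := 0) (by decide)
    (regs [] [] (out₁ i).reverse (inp i).reverse)
  simp only [regs_zero, regs_one, regs_two, regs_three, update_regs_zero, update_regs_one,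
    update_regs_two, update_regs_three, List.append_nil, List.reverse_reverse,
    List.length_reverse] at m₁ m₂ m₃
  refine ((Reach.dup _).seq ((hp i _ _ _).seq (m₁.seq (m₂.seq (m₃.seq ((hr i _ _ _).seq
    (Reach.pack (out₁ i) [] (out₂ i)))))))).mono ?_
  have := hq i
  simp
  omega

theorem fst (inp : ι → List Bool × List Bool) :
    Poly (fun i => block (inp i).1 ++ (inp i).2) fun i => (inp i).1 :=
  of_regs (c := .seq .unpack (.seq (.clear 0) (.move 1 0)))
    ⟨Prog.queryFree_unpack, Prog.queryFree_clear _, Prog.queryFree_move _ _⟩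
    (12 * .X + 8) fun i => by
      have m₁ := Reach.clear 0 (regs (inp i).2 (inp i).1.reverse [] [])
      have m₂ := Reach.move (r := 1) (q := 0) (by decide) (regs [] (inp i).1.reverse [] [])
      simp only [regs_zero, regs_one, update_regs_zero, update_regs_one,
        List.append_nil, List.reverse_reverse, List.length_reverse] at m₁ m₂
      refine ((Reach.unpack _ _).seq (m₁.seq m₂)).mono ?_
      have : (inp i).1.length ≤ (block (inp i).1).length := by
        induction (inp i).1 with
        | nil => simp
        | cons a w ih => simp only [block, List.length_cons]; omega
      simp
      omega

theorem snd (inp : ι → List Bool × List Bool) :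
    Poly (fun i => block (inp i).1 ++ (inp i).2) fun i => (inp i).2 :=
  of_regs (c := .seq .unpack (.clear 1))
    ⟨Prog.queryFree_unpack, Prog.queryFree_clear _⟩
    (12 * .X + 8) fun i => by
      have m₁ := Reach.clear 1 (regs (inp i).2 (inp i).1.reverse [] [])
      simp only [regs_one, update_regs_one, List.length_reverse] at m₁
      refine ((Reach.unpack _ _).seq m₁).mono ?_
      have : (inp i).1.length ≤ (block (inp i).1).length := by
        induction (inp i).1 with
        | nil => simp
        | cons a w ih => simp only [block, List.length_cons]; omega
      simp
      omega

theorem append_of_block (inp : ι → List Bool × List Bool) :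
    Poly (fun i => block (inp i).1 ++ (inp i).2) fun i => (inp i).1 ++ (inp i).2 :=
  of_regs (c := .seq .unpack (.move 1 0))
    ⟨Prog.queryFree_unpack, Prog.queryFree_move _ _⟩
    (12 * .X + 8) fun i => by
      have m₂ := Reach.move (r := 1) (q := 0) (by decide)
        (regs (inp i).2 (inp i).1.reverse [] [])
      simp only [regs_zero, regs_one, update_regs_zero, update_regs_one,
        List.reverse_reverse, List.length_reverse] at m₂
      refine ((Reach.unpack _ _).seq m₂).mono ?_
      have : (inp i).1.length ≤ (block (inp i).1).length := by
        induction (inp i).1 with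
        | nil => simp
        | cons a w ih => simp only [block, List.length_cons]; omega
      simp
      omega

theorem append {out₁ out₂ : ι → List Bool} (h₁ : Poly inp out₁) (h₂ : Poly inp out₂) :
    Poly inp fun i => out₁ i ++ out₂ i :=
  (h₁.pair h₂).trans (append_of_block fun i => (out₁ i, out₂ i))

/-- Each branch has to work only on the instances that reach it, so a branch may use a destructor
that makes sense only there. -/
theorem cases {cnd : ι → List Bool} (hc : Poly inp cnd)
    (h₀ : Poly (fun i : {i // (cnd i).head? = none} => inp i) fun i => out i)
    (h₁ : Poly (fun i : {i // (cnd i).head? = some false} => inp i) fun i => out i)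
    (h₂ : Poly (fun i : {i // (cnd i).head? = some true} => inp i) fun i => out i) :
    Poly inp out := by
  obtain ⟨q, hq⟩ := hc.length_le
  obtain ⟨c, hc, p, hp⟩ := hc.frame
  obtain ⟨d₀, hd₀, r₀, hr₀⟩ := h₀.frame
  obtain ⟨d₁, hd₁, r₁, hr₁⟩ := h₁.frame
  obtain ⟨d₂, hd₂, r₂, hr₂⟩ := h₂.frame
  refine of_regs (c := .seq .dup (.seq c (.test 0 (.seq .restore d₀) (.seq .restore d₁)
    (.seq .restore d₂))))
    ⟨Prog.queryFree_dup, hc, ⟨Prog.queryFree_restore, hd₀⟩, ⟨Prog.queryFree_restore, hd₁⟩,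
      ⟨Prog.queryFree_restore, hd₂⟩⟩
    (17 * .X + 6 + p + r₀ + r₁ + r₂ + 2 * q) fun i => ?_
  have hq := hq i
  have hp := hp i (inp i) [] []
  have hx := Reach.restore (cnd i) (inp i)
  rcases h : cnd i with _ | ⟨_ | _, l⟩ <;> rw [h] at hp hx hq
  · refine ((Reach.dup _).seq (hp.seq (Reach.test_empty (by simp)
      (hx.seq (hr₀ ⟨i, by simp [h]⟩ _ _ _))))).mono ?_
    simp; omega
  · refine ((Reach.dup _).seq (hp.seq (Reach.test_zero (l := l) (by simp)
      (hx.seq (hr₁ ⟨i, by simp [h]⟩ _ _ _))))).mono ?_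
    simp at hq ⊢; omega
  · refine ((Reach.dup _).seq (hp.seq (Reach.test_one (l := l) (by simp)
      (hx.seq (hr₂ ⟨i, by simp [h]⟩ _ _ _))))).mono ?_
    simp at hq ⊢; omega

/-- The string `cnt i` is a unary loop counter. The bound on all intermediate states is essential: a
polynomial-time step repeated polynomially often could otherwise produce strings of exponential
length. -/
theorem iterate {cnt : ι → List Bool} {st : ι → ℕ → List Bool} (hc : Poly inp cnt)
    (h₀ : Poly inp fun i => st i 0)
    (hs : Poly (fun x : ι × ℕ => st x.1 x.2) fun x => st x.1 (x.2 + 1))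
    (hb : ∃ p : Polynomial ℕ, ∀ i k, k ≤ (cnt i).length →
      (st i k).length ≤ p.eval (inp i).length) :
    Poly inp fun i => st i (cnt i).length := by
  obtain ⟨b, hb⟩ := hb
  obtain ⟨q, hq⟩ := hc.length_le
  obtain ⟨c, hc, p, hp⟩ := hc.frame
  obtain ⟨d, hd, r, hr⟩ := h₀.frame
  obtain ⟨e, he, u, hu⟩ := hs.frame
  refine of_regs (c := .seq .dup (.seq c (.seq (.move 0 2) (.seq (.move 1 3) (.seq (.move 3 0)
    (.seq d (.loop 2 (.seq (.pop 2) e))))))))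
    ⟨Prog.queryFree_dup, hc, Prog.queryFree_move _ _, Prog.queryFree_move _ _,
      Prog.queryFree_move _ _, hd, trivial, he⟩
    (17 * .X + 6 + p + r + 4 * q + q * (u.comp b + 2)) fun i => ?_
  have m₁ := Reach.move (r := 0) (q := 2) (by decide) (regs (cnt i) (inp i) [] [])
  have m₂ := Reach.move (r := 1) (q := 3) (by decide) (regs [] (inp i) (cnt i).reverse [])
  have m₃ := Reach.move (r := 3) (q := 0) (by decide)
    (regs [] [] (cnt i).reverse (inp i).reverse)
  simp only [regs_zero, regs_one, regs_two, regs_three, update_regs_zero, update_regs_one,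
    update_regs_two, update_regs_three, List.append_nil, List.reverse_reverse,
    List.length_reverse] at m₁ m₂ m₃
  have loop : ∀ (v : List Bool) (k : ℕ), k + v.length = (cnt i).length →
      Reach (.loop 2 (.seq (.pop 2) e)) (regs (st i k) [] v [])
        (regs (st i (cnt i).length) [] [] [])
        (v.length * (u.eval (b.eval (inp i).length) + 2) + 1) := by
    intro v
    induction v with
    | nil =>
        intro k hk
        rw [show k = (cnt i).length by simpa using hk]
        exact (Reach.loop_done rfl).mono (by simp)
    | cons a v ih =>
        intro k hk
        rw [List.length_cons] at hk
        have h₁ := Reach.pop 2 (regs (st i k) [] (a :: v) [])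
        simp only [regs_two, update_regs_two, List.tail_cons] at h₁
        have h₂ := hu (i, k) [] v []
        have h₃ := u.eval_mono_nat (hb i k (by omega))
        refine (Reach.loop_step (by simp) (h₁.seq h₂) (ih (k + 1) (by omega))).mono ?_
        rw [List.length_cons, add_mul]
        simp only
        omega
  refine ((Reach.dup _).seq ((hp i _ _ _).seq (m₁.seq (m₂.seq (m₃.seq ((hr i _ _ _).seq
    (loop (cnt i).reverse 0 (by simp)))))))).mono ?_
  have h₁ := hq i
  have h₂ := Nat.mul_le_mul_right (u.eval (b.eval (inp i).length) + 2) h₁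
  simp only [Polynomial.eval_add, Polynomial.eval_mul, Polynomial.eval_comp, Polynomial.eval_X,
    Polynomial.eval_ofNat, List.length_reverse]
  omega

/-- Empty the registers `1, …, n`. -/
def clearUpTo : ℕ → Prog
  | 0 => .skip
  | n + 1 => .seq (clearUpTo n) (.clear (n + 1))

theorem queryFree_clearUpTo : ∀ n, (clearUpTo n).QueryFree
  | 0 => trivial
  | n + 1 => ⟨queryFree_clearUpTo n, trivial⟩

theorem reach_clearUpTo (n : ℕ) (s : Store) {B : ℕ} (hB : ∀ r, (s r).length ≤ B) :
    Reach (clearUpTo n) s (fun r => if 1 ≤ r ∧ r ≤ n then [] else s r)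
      (1 + n * (2 * B + 1)) := by
  induction n with
  | zero =>
      refine ⟨1, by simp, ?_⟩
      convert Exec.skip s using 1
      · rfl
      funext r
      rw [if_neg (by omega)]
  | succ n ih =>
      have h := ih.seq (Reach.clear (n + 1) _)
      refine (Reach.mono ?_ (T := 1 + n * (2 * B + 1) + (2 * (s (n + 1)).length + 1)) ?_)
      · convert h using 1
        · rfl
        · funext r
          by_cases hr : r = n + 1
          · subst hr; simp
          · simp only [Function.update_of_ne hr]
            congr 1
            simp only [eq_iff_iff]
            omega
        · simp
      · have := hB (n + 1)
        rw [add_mul]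
        omega

/-- The given program may leave garbage outside register `0`. Registers from `c.bound` on are
untouched, and the others have length at most input length plus time, so clearing them keeps the
time polynomial. -/
theorem of_polyTimeSolvable {R : ι → List Bool → Prop} (h : PolyTimeSolvable inp R) :
    ∃ out : ι → List Bool, Poly inp out ∧ ∀ i, R i (out i) := by
  obtain ⟨c, hc, p, hp⟩ := h
  choose out t hcomp ht hR using hp
  refine ⟨out, ⟨.seq c (clearUpTo c.bound), ⟨hc, queryFree_clearUpTo _⟩,
    p + 1 + .C c.bound * (2 * (.X + p) + 1), fun i => ?_⟩, hR⟩
  obtain ⟨s, e, hs⟩ := hcomp i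
  have hB : ∀ r, (s r).length ≤ (inp i).length + p.eval (inp i).length := by
    intro r
    have h₁ := e.length_le hc r
    have h₂ : (inputStore (inp i) r).length ≤ (inp i).length := by
      simp only [inputStore]
      split_ifs <;> simp
    have := ht i
    omega
  have h := Reach.seq ⟨t i, le_rfl, e⟩ (reach_clearUpTo c.bound s hB)
  have hfin : (fun r => if 1 ≤ r ∧ r ≤ c.bound then [] else s r) = inputStore (out i) := by
    funext r
    rcases Nat.eq_zero_or_pos r with rfl | hr
    · simp [inputStore, hs]
    · by_cases hb : r ≤ c.bound
      · rw [if_pos ⟨hr, hb⟩]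
        simp [inputStore, hr.ne']
      · rw [if_neg (by omega), e.eq_of_bound_le (by omega)]
        simp [inputStore, hr.ne']
  rw [hfin] at h
  refine h.mono ?_
  have := ht i
  simp only [Polynomial.eval_add, Polynomial.eval_mul, Polynomial.eval_X, Polynomial.eval_C,
    Polynomial.eval_ofNat, Polynomial.eval_one]
  omega

/-- A query-free run is the same for every oracle, and strings outside the promise impose no
condition. -/
theorem mem_polyTimeClass (O : List Bool → List Bool) {X : PromiseProblem}
    {inp out : ι → List Bool} (h : Poly inp out)
    (hX : ∀ w ∈ X.accept ∪ X.reject, ∃ i, inp i = w ∧ (w ∈ X.accept → out i = [true]) ∧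
      (w ∈ X.reject → out i = [false])) : X ∈ PolyTimeClass O := by
  obtain ⟨c, hc, p, hp⟩ := h
  refine ⟨c, p, fun ⟨w, hw⟩ => ?_⟩
  obtain ⟨i, rfl, h₁, h₂⟩ := hX w hw
  obtain ⟨t, ht, e⟩ := hp i
  exact ⟨out i, t, ⟨_, e.of_queryFree hc, by simp [inputStore]⟩, ht, h₁, h₂⟩

end Poly

/-! ### Polynomial time functions between encoded types -/

/-- An encoding of the elements of a type by bit strings. -/
class Enc (α : Type*) where
  enc : α → List Bool

/-- The encoding is injective. -/
class InjEnc (α : Type*) [Enc α] : Prop where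
  inj : Function.Injective (Enc.enc : α → List Bool)

open Enc

instance instEncList {α : Type*} [Enc α] : Enc (List α) := ⟨fun l => encList (l.map enc)⟩

instance instEncProd {α β : Type*} [Enc α] [Enc β] : Enc (α × β) :=
  ⟨fun x => block (enc x.1) ++ enc x.2⟩

instance instEncSubtype {α : Type*} [Enc α] {p : α → Prop} : Enc (Subtype p) := ⟨fun x => enc x.1⟩

instance instEncBool : Enc Bool := ⟨fun b => [b]⟩

/-- `List Bool` also matches `instEncList`; the priority makes a string encode itself instead of
being split into one-bit blocks. -/
instance (priority := high) instEncString : Enc (List Bool) := ⟨fun w => w⟩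

instance instEncInt : Enc ℤ := ⟨encInt⟩

section basic
variable {α β : Type*} [Enc α] [Enc β]

theorem enc_prod (a : α) (b : β) : enc (a, b) = block (enc a) ++ enc b := rfl

theorem enc_nil : enc ([] : List α) = [] := rfl

/-- A nonempty list and the pair of its head and tail are the same string, so building and
destructing lists needs no conversion. -/
theorem enc_cons (a : α) (l : List α) : enc (a :: l) = enc (a, l) := rfl

theorem enc_append (l l' : List α) : enc (l ++ l') = enc l ++ enc l' := by
  simp [enc, encList]

theorem enc_string (w : List Bool) : enc w = w := rfl

theorem enc_bool (b : Bool) : enc b = [b] := rfl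

theorem length_block (w : List Bool) : (block w).length = 2 * w.length + 1 := by
  induction w with
  | nil => rfl
  | cons a w ih => simp only [block, List.length_cons]; omega

theorem length_enc_prod (a : α) (b : β) :
    (enc (a, b)).length = 2 * (enc a).length + 1 + (enc b).length := by
  rw [enc_prod, List.length_append, length_block]

theorem length_enc_cons (a : α) (l : List α) :
    (enc (a :: l)).length = 2 * (enc a).length + 1 + (enc l).length := by
  rw [enc_cons, length_enc_prod]

theorem length_enc_append (l l' : List α) :
    (enc (l ++ l')).length = (enc l).length + (enc l').length := by
  rw [enc_append, List.length_append]

theorem length_le_length_enc (l : List α) : l.length ≤ (enc l).length := by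
  induction l with
  | nil => simp
  | cons a l ih => rw [length_enc_cons, List.length_cons]; omega

theorem length_enc_le_of_mem {a : α} {l : List α} (h : a ∈ l) :
    (enc a).length ≤ (enc l).length := by
  induction l with
  | nil => simp at h
  | cons b l ih =>
      rw [length_enc_cons]
      rcases List.mem_cons.1 h with rfl | h
      · omega
      · have := ih h; omega

theorem length_enc_le_of_forall {l : List α} {B : ℕ} (h : ∀ a ∈ l, (enc a).length ≤ B) :
    (enc l).length ≤ l.length * (2 * B + 1) := by
  induction l with
  | nil => simp [enc_nil]
  | cons b l ih =>
      rw [length_enc_cons, List.length_cons, add_mul]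
      have := ih fun a ha => h a (List.mem_cons_of_mem _ ha)
      have := h b List.mem_cons_self
      omega

theorem length_enc_le_of_isPrefix {l l' : List α} (h : l' <+: l) :
    (enc l').length ≤ (enc l).length := by
  obtain ⟨t, rfl⟩ := h
  rw [length_enc_append]; omega

theorem length_enc_drop_le (l : List α) (k : ℕ) : (enc (l.drop k)).length ≤ (enc l).length := by
  conv_rhs => rw [← List.take_append_drop k l, length_enc_append]
  omega

instance : InjEnc (List Bool) := ⟨fun _ _ h => h⟩

instance [InjEnc α] [InjEnc β] : InjEnc (α × β) := ⟨by
  rintro ⟨a, b⟩ ⟨a', b'⟩ h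
  obtain ⟨h₁, h₂⟩ := block_append_inj h
  exact Prod.ext (InjEnc.inj h₁) (InjEnc.inj h₂)⟩

instance [InjEnc α] : InjEnc (List α) :=
  ⟨fun _ _ h => List.map_injective_iff.2 InjEnc.inj (encList_injective h)⟩

end basic

/-- The function `f` is computed on encodings in polynomial time. -/
def PF {α β : Type*} [Enc α] [Enc β] (f : α → β) : Prop :=
  Poly (enc : α → List Bool) fun a => enc (f a)

open Classical in
/-- The predicate `p` is decided on encodings in polynomial time. -/
def PD {α : Type*} [Enc α] (p : α → Prop) : Prop := PF fun a => decide (p a)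

/-! ### Closure properties of polynomial-time functions and predicates. -/

namespace PF

variable {α β γ σ : Type*} [Enc α] [Enc β] [Enc γ] [Enc σ]

theorem congr {f g : α → β} (h : PF f) (hfg : ∀ a, f a = g a) : PF g := by
  rwa [← funext hfg]

theorem id : PF fun a : α => a := Poly.refl _

theorem comp {g : β → γ} {f : α → β} (hg : PF g) (hf : PF f) : PF fun a => g (f a) :=
  Poly.trans hf (Poly.reindex hg f)

theorem const (b : β) : PF fun _ : α => b := Poly.const _ _

theorem pair {f : α → β} {g : α → γ} (hf : PF f) (hg : PF g) : PF fun a => (f a, g a) :=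
  Poly.pair hf hg

theorem fst {f : α → β × γ} (hf : PF f) : PF fun a => (f a).1 :=
  Poly.trans hf (Poly.fst fun a => (enc (f a).1, enc (f a).2))

theorem snd {f : α → β × γ} (hf : PF f) : PF fun a => (f a).2 :=
  Poly.trans hf (Poly.snd fun a => (enc (f a).1, enc (f a).2))

theorem comp₂ {g : β → γ → σ} {u : α → β} {v : α → γ} (hg : PF fun x : β × γ => g x.1 x.2)
    (hu : PF u) (hv : PF v) : PF fun a => g (u a) (v a) := comp hg (hu.pair hv)

theorem cons {f : α → β} {g : α → List β} (hf : PF f) (hg : PF g) : PF fun a => f a :: g a :=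
  Poly.pair hf hg

theorem append {f g : α → List β} (hf : PF f) (hg : PF g) : PF fun a => f a ++ g a :=
  (Poly.append hf hg).congr fun _ => (enc_append _ _).symm

theorem of_isEmpty [IsEmpty α] (f : α → β) : PF f :=
  ⟨.skip, trivial, 0, isEmptyElim⟩

theorem stringCases {s : α → List Bool} {out f₀ f₁ f₂ : α → β} (hs : PF s) (h₀ : PF f₀)
    (h₁ : PF f₁) (h₂ : PF f₂) (e₀ : ∀ a, s a = [] → out a = f₀ a)
    (e₁ : ∀ a w, s a = false :: w → out a = f₁ a)
    (e₂ : ∀ a w, s a = true :: w → out a = f₂ a) : PF out := by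
  refine Poly.cases hs ?_ ?_ ?_
  · refine (Poly.reindex h₀ Subtype.val).congr fun ⟨a, ha⟩ => ?_
    rw [e₀ a (by simpa [enc_string] using ha)]
  · refine (Poly.reindex h₁ Subtype.val).congr fun ⟨a, ha⟩ => ?_
    obtain ⟨w, hw⟩ := List.head?_eq_some_iff.1 ha
    rw [e₁ a w hw]
  · refine (Poly.reindex h₂ Subtype.val).congr fun ⟨a, ha⟩ => ?_
    obtain ⟨w, hw⟩ := List.head?_eq_some_iff.1 ha
    rw [e₂ a w hw]

theorem stringTail {s : α → List Bool} (hs : PF s) : PF fun a => (s a).tail := Poly.tail hs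

theorem stringCons (b : Bool) {s : α → List Bool} (hs : PF s) : PF fun a => b :: s a :=
  Poly.cons b hs

theorem ite {p : α → Prop} [DecidablePred p] {f g : α → β} (hp : PD p)
    (hf : PF f) (hg : PF g) : PF fun a => if p a then f a else g a := by
  classical
  refine stringCases (s := fun a => [@decide (p a) (Classical.propDecidable _)]) hp hg hg hf ?_ ?_ ?_
  · intro a h; simp at h
  · intro a w h
    rw [if_neg (by simpa using (List.cons.inj h).1)]
  · intro a w h
    rw [if_pos (by simpa using (List.cons.inj h).1)]

/-- Only the empty list has an empty encoding. The first bit of a nonempty encoding can be either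
one, so both bits lead to the same branch, in which `l a` is reread as the pair of its head and
tail. -/
theorem listCases {l : α → List β} {out f : α → γ} {g : α → β → List β → γ} (hl : PF l)
    (hf : PF f) (hg : PF fun x : α × β × List β => g x.1 x.2.1 x.2.2)
    (e₀ : ∀ a, l a = [] → out a = f a) (e₁ : ∀ a b t, l a = b :: t → out a = g a b t) :
    PF out := by
  have key : ∀ x : Bool, Poly (fun a : {a // (enc (l a)).head? = some x} => enc a)
      fun a => enc (out a) := by
    intro x
    have hne : ∀ a : {a // (enc (l a)).head? = some x}, ∃ b t, l a = b :: t := by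
      rintro ⟨a, ha⟩
      rcases h : l a with _ | ⟨b, t⟩
      · simp [h, enc_nil] at ha
      · exact ⟨b, t, rfl⟩
    choose b t hbt using hne
    have h₁ : Poly (fun a : {a // (enc (l a)).head? = some x} => enc a)
        fun a => enc (a.1, l a) := Poly.reindex (pair id hl) Subtype.val
    have h₂ := Poly.reindex hg fun a : {a // (enc (l a)).head? = some x} => (a.1, b a, t a)
    exact (h₁.congr fun a => by rw [hbt a]; rfl).trans (h₂.congr fun a => by rw [e₁ a _ _ (hbt a)])
  refine Poly.cases hl ?_ (key false) (key true)
  refine (Poly.reindex hf Subtype.val).congr fun ⟨a, ha⟩ => ?_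
  have : l a = [] := by
    rcases h : l a with _ | ⟨b, t⟩
    · rfl
    · rw [h, enc_cons, enc_prod] at ha
      simp [block_ne_nil] at ha
  rw [e₀ a this]

/-- The fold is an iteration on triples of parameter, current state and remaining list. The encoding
of the list serves as the counter; it is at least as long as the list, and surplus rounds are idle
because the step fixes a triple with nothing remaining. -/
theorem foldl {l : α → List β} {init : α → σ} {step : α → σ → β → σ} (hl : PF l)
    (hi : PF init) (hs : PF fun x : α × σ × β => step x.1 x.2.1 x.2.2)
    (hb : ∃ p : Polynomial ℕ, ∀ a l', l' <+: l a →
      (enc (l'.foldl (step a) (init a))).length ≤ p.eval (enc a).length) :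
    PF fun a => (l a).foldl (step a) (init a) := by
  let F : α × σ × List β → α × σ × List β := fun x =>
    match x.2.2 with
    | [] => x
    | b :: t => (x.1, step x.1 x.2.1 b, t)
  let G : α × ℕ → α × σ × List β := fun x =>
    (x.1, ((l x.1).take x.2).foldl (step x.1) (init x.1), (l x.1).drop x.2)
  have hF : PF F := by
    refine listCases (l := fun x : α × σ × List β => x.2.2) (f := fun x => x)
      (g := fun x b t => (x.1, step x.1 x.2.1 b, t)) id.snd.snd id ?_ ?_ ?_
    · exact id.fst.fst.pair
        ((hs.comp (id.fst.fst.pair (id.fst.snd.fst.pair id.snd.fst))).pair id.snd.snd)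
    · intro x hx; simp only [F, hx]
    · intro x b t hx; simp only [F, hx]
  have hFG : ∀ x : α × ℕ, F (G x) = G (x.1, x.2 + 1) := by
    rintro ⟨a, k⟩
    simp only [F, G]
    rcases h : (l a).drop k with _ | ⟨b, t⟩
    · have hk : (l a).length ≤ k := by simpa using h
      simp [List.take_of_length_le hk, List.take_of_length_le (hk.trans (Nat.le_succ k)),
        List.drop_of_length_le (hk.trans (Nat.le_succ k))]
    · have hk : k < (l a).length := by
        by_contra hk
        rw [List.drop_of_length_le (by omega)] at h
        cases h
      rw [List.drop_eq_getElem_cons hk] at h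
      obtain ⟨rfl, rfl⟩ := List.cons.inj h
      simp only [Prod.mk.injEq, true_and, and_true]
      rw [List.take_add_one, List.getElem?_eq_getElem hk, Option.toList_some, List.foldl_append]
      rfl
  have h := Poly.iterate (cnt := fun a => enc (l a)) (st := fun a k => enc (G (a, k))) hl
    ((id.pair (hi.pair hl)).congr fun a => by simp [G])
    ((Poly.reindex hF G).congr fun x => by rw [hFG]) ?_
  · have h' : PF fun a => (a, (l a).foldl (step a) (init a), ([] : List β)) :=
      h.congr fun a => by
        have := length_le_length_enc (l a)
        simp [G, List.take_of_length_le this, List.drop_of_length_le this]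
    exact h'.snd.fst
  · obtain ⟨p, hp⟩ := hb
    obtain ⟨q, hq⟩ := hl.length_le
    refine ⟨2 * .X + 2 + 2 * p + q, fun a k _ => ?_⟩
    have h₁ := hp a _ (List.take_prefix k (l a))
    have h₂ := hq a
    have h₃ := length_enc_drop_le (l a) k
    simp only [G, length_enc_prod, Polynomial.eval_add, Polynomial.eval_mul, Polynomial.eval_X,
      Polynomial.eval_ofNat]
    omega

theorem flatMap {l : α → List β} {f : α → β → List γ} (hl : PF l)
    (hf : PF fun x : α × β => f x.1 x.2) : PF fun a => (l a).flatMap (f a) := by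
  have e : ∀ (a : α) (l' : List β) (s : List γ), l'.foldl (fun s b => s ++ f a b) s = s ++ l'.flatMap (f a) := by
    intro a l'
    induction l' with
    | nil => simp
    | cons b l' ih => intro s; simp [ih]
  refine (foldl (step := fun a s b => s ++ f a b) hl (const ([] : List γ))
    (id.snd.fst.append (hf.comp (id.fst.pair id.snd.snd))) ?_).congr fun a => by simp [e]
  obtain ⟨p, hp⟩ := hf.length_le
  obtain ⟨q, hq⟩ := hl.length_le
  refine ⟨q * p.comp (2 * .X + 1 + q), fun a l' hl' => ?_⟩
  simp only [e, List.nil_append, Polynomial.eval_mul, Polynomial.eval_comp, Polynomial.eval_add,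
    Polynomial.eval_X, Polynomial.eval_ofNat, Polynomial.eval_one]
  set B := p.eval (2 * (enc a).length + 1 + q.eval (enc a).length)
  have hB : ∀ b ∈ l', (enc (f a b)).length ≤ B := by
    intro b hb
    refine (hp (a, b)).trans (p.eval_mono_nat ?_)
    have := length_enc_le_of_mem (hl'.subset hb)
    have := hq a
    rw [length_enc_prod]
    omega
  have h₁ : (enc (l'.flatMap (f a))).length ≤ l'.length * B := by
    clear hl'
    induction l' with
    | nil => simp [enc_nil]
    | cons b l' ih =>
        rw [List.flatMap_cons, length_enc_append, List.length_cons, add_mul]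
        have := ih fun b hb => hB b (List.mem_cons_of_mem _ hb)
        have := hB b List.mem_cons_self
        omega
  have h₂ : l'.length ≤ q.eval (enc a).length :=
    hl'.length_le.trans ((length_le_length_enc _).trans (hq a))
  exact h₁.trans (Nat.mul_le_mul_right _ h₂)

theorem map {l : α → List β} {f : α → β → γ} (hl : PF l) (hf : PF fun x : α × β => f x.1 x.2) :
    PF fun a => (l a).map (f a) :=
  (flatMap (f := fun a b => [f a b]) hl (hf.cons (const []))).congr fun a => by
    rw [List.map_eq_flatMap]

theorem pd_comp {p : β → Prop} {f : α → β} (hp : PD p) (hf : PF f) : PD fun a => p (f a) :=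
  comp hp hf

open Classical in
theorem not {p : α → Prop} (hp : PD p) : PD fun a => ¬ p a :=
  PF.congr (ite hp (const false) (const true)) fun a => by by_cases h : p a <;> simp [h]

open Classical in
theorem and {p q : α → Prop} (hp : PD p) (hq : PD q) : PD fun a => p a ∧ q a :=
  PF.congr (ite hp hq (const false)) fun a => by by_cases h : p a <;> simp [h]

open Classical in
theorem forall_mem {l : α → List β} {p : α → β → Prop} (hl : PF l)
    (hp : PD fun x : α × β => p x.1 x.2) : PD fun a => ∀ b ∈ l a, p a b := by
  refine PF.congr (foldl (step := fun a (s : Bool) b => if p a b then s else false) hl (const true)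
    (ite (PF.comp hp (id.fst.pair id.snd.snd)) id.snd.fst (const false)) ⟨1, fun a l' _ => by
      simp [enc_bool]⟩) fun a => ?_
  have e : ∀ (l' : List β) (s : Bool), l'.foldl (fun (s : Bool) b => if p a b then s else false) s =
      (s && decide (∀ b ∈ l', p a b)) := by
    intro l'
    induction l' with
    | nil => simp
    | cons b l' ih =>
        intro s
        rw [List.foldl_cons, ih]
        by_cases h : p a b <;> simp [h]
  rw [e, Bool.true_and]
  exact decide_eq_decide.2 Iff.rfl

theorem string_eq : PD fun x : List Bool × List Bool => x.1 = x.2 := by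
  classical
  -- Equal leading bits are cancelled; a mismatch leads to the unequal pair `([true], [])`, which is
  -- a fixed point. Equality of the components is thus invariant, and after as many rounds as the
  -- first string has bits, both components are empty exactly if the strings were equal.
  let F : List Bool × List Bool → List Bool × List Bool := fun x =>
    match x with
    | (a :: v, b :: w) => if a = b then (v, w) else ([true], [])
    | x => x
  have hF : PF F := by
    have key : ∀ c : Bool, PF fun x : List Bool × List Bool =>
        match x.2 with
        | b :: w => if c = b then (x.1.tail, w) else ([true], [])
        | [] => x := by
      intro c
      cases c
      · refine stringCases (s := fun x : List Bool × List Bool => x.2) id.snd id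
          (id.fst.stringTail.pair id.snd.stringTail) (const ([true], [])) ?_ ?_ ?_
        all_goals rintro ⟨x, y⟩; simp +contextual
      · refine stringCases (s := fun x : List Bool × List Bool => x.2) id.snd id
          (const ([true], [])) (id.fst.stringTail.pair id.snd.stringTail) ?_ ?_ ?_
        all_goals rintro ⟨x, y⟩; simp +contextual
    refine stringCases (s := fun x : List Bool × List Bool => x.1) id.fst id
      (key false) (key true) ?_ ?_ ?_
    · rintro ⟨x, y⟩ h
      simp only at h
      subst h
      rfl
    all_goals
      rintro ⟨x, y⟩ w h
      simp only at h
      subst h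
      rcases y with _ | ⟨b, y⟩ <;> rfl
  have inv : ∀ x, (F x).1 = (F x).2 ↔ x.1 = x.2 := by
    rintro ⟨_ | ⟨a, v⟩, _ | ⟨b, w⟩⟩ <;> simp only [F] <;> try rfl
    split_ifs with h <;> simp [h]
  have inv' : ∀ k x, (F^[k] x).1 = (F^[k] x).2 ↔ x.1 = x.2 := by
    intro k
    induction k with
    | zero => intro x; rfl
    | succ k ih => intro x; rw [Function.iterate_succ_apply, ih, inv]
  have diag : ∀ (w : List Bool), F^[w.length] (w, w) = ([], []) := by
    intro w
    induction w with
    | nil => rfl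
    | cons a w ih =>
        rw [List.length_cons, Function.iterate_succ_apply]
        simpa [F] using ih
  -- The `+ 1` leaves room for the mismatch marker `[true]`.
  have size : ∀ k x, (F^[k] x).1.length ≤ x.1.length + 1 ∧
      (F^[k] x).2.length ≤ x.2.length := by
    have step : ∀ x n m, x.1.length ≤ n + 1 → x.2.length ≤ m →
        (F x).1.length ≤ n + 1 ∧ (F x).2.length ≤ m := by
      rintro ⟨_ | ⟨a, v⟩, _ | ⟨b, w⟩⟩ n m h₁ h₂ <;> simp only [F] <;>
        try exact ⟨h₁, h₂⟩
      simp only [List.length_cons] at h₁ h₂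
      split_ifs <;> simp <;> omega
    intro k x
    induction k with
    | zero => simp
    | succ k ih => rw [Function.iterate_succ_apply']; exact step _ _ _ ih.1 ih.2
  have hit : PF fun x : List Bool × List Bool => F^[x.1.length] x := by
    refine Poly.iterate (inp := fun x : List Bool × List Bool => enc x) (cnt := fun x => x.1) (st := fun x k => enc (F^[k] x)) id.fst id
      ((Poly.reindex hF fun x : (List Bool × List Bool) × ℕ => F^[x.2] x.1).congr fun x => by
        rw [Function.iterate_succ_apply']) ⟨.X + 2, fun x k _ => ?_⟩
    obtain ⟨h₁, h₂⟩ := size k x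
    rw [show x = (x.1, x.2) from rfl, length_enc_prod,
      show F^[k] (x.1, x.2) = ((F^[k] x).1, (F^[k] x).2) from rfl, length_enc_prod]
    simp only [enc_string, Polynomial.eval_add, Polynomial.eval_X, Polynomial.eval_ofNat]
    omega
  have hnil : PD fun w : List Bool => w = [] := by
    refine stringCases (s := fun w => w) id (const true) (const false) (const false) ?_ ?_ ?_ <;>
      simp +contextual
  refine PF.congr (and (pd_comp hnil hit.fst) (pd_comp hnil hit.snd)) fun x => ?_
  have : (F^[x.1.length] x).1 = [] ∧ (F^[x.1.length] x).2 = [] ↔ x.1 = x.2 := by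
    rw [← inv' x.1.length x]
    refine ⟨fun h => h.1.trans h.2.symm, fun h => ?_⟩
    rw [inv'] at h
    obtain ⟨v, w⟩ := x
    simp only at h
    subst h
    simp [diag]
  exact decide_eq_decide.2 this

theorem eq [InjEnc β] {f g : α → β} (hf : PF f) (hg : PF g) : PD fun a => f a = g a := by
  have h : PF fun a => (enc (f a), enc (g a)) := Poly.pair hf hg
  refine PF.congr (pd_comp string_eq h) fun a => ?_
  simp only [decide_eq_decide]
  exact InjEnc.inj.eq_iff

theorem mem [InjEnc β] {f : α → β} {l : α → List β} (hf : PF f) (hl : PF l) :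
    PD fun a => f a ∈ l a := by
  have h := (forall_mem (p := fun a b => ¬ f a = b) hl
    (not (eq (hf.comp id.fst) id.snd)))
  refine PF.congr (not h) fun a => ?_
  simp only [decide_eq_decide]
  constructor
  · intro h
    push Not at h
    obtain ⟨b, hb, h⟩ := h
    rwa [h]
  · exact fun h h' => h' _ h rfl

/-- A function on a finite type is a table, realized by finitely many comparisons. In this way all
arithmetic modulo the fixed `m` is computed, including functions obtained by choice such as `bezout`
and `annihilator`. -/
theorem of_finite [Finite α] [InjEnc α] (f : α → β) : PF f := by
  classical
  rcases isEmpty_or_nonempty α with h | ⟨⟨a₀⟩⟩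
  · exact of_isEmpty f
  have key : ∀ l : List α, PF fun a => if a ∈ l then f a else f a₀ := by
    intro l
    induction l with
    | nil => simpa using const (f a₀)
    | cons b l ih =>
        refine (ite (eq id (const b)) (const (f b)) ih).congr fun a => ?_
        by_cases h : a = b
        · simp [h]
        · simp [h]
  have := Fintype.ofFinite α
  simpa using key Finset.univ.toList

end PF

/-! ### Linear equations modulo `m` -/

theorem encNat_injective : Function.Injective encNat := by
  intro a b h
  have key : ∀ n : ℕ, (n.bits.foldr (fun c k => Nat.bit c k) 0) = n := by
    intro n
    induction n using Nat.binaryRec' with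
    | zero => simp
    | bit c n hn ih => rw [Nat.bits_append_bit n c hn, List.foldr_cons, ih]
  rw [← key a, ← key b]
  exact congrArg _ h

/-- Over `ZMod m` a pivot cannot be divided by. With `g` the gcd of the representatives, `a = g α`,
`a' = g β` and `x α + y β = 1`, the matrix with rows `(x, y)` and `(-β, α)` has determinant `1` and
its second row kills `(a, a')`. -/
theorem ZMod.exists_bezout {m : ℕ} [NeZero m] (a a' : ZMod m) : ∃ t : ZMod m × ZMod m × ZMod m × ZMod m,
    t.2.2.1 * a + t.2.2.2 * a' = 0 ∧ t.1 * t.2.2.2 - t.2.1 * t.2.2.1 = 1 := by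
  by_cases h : a.val = 0 ∧ a'.val = 0
  · rw [ZMod.val_eq_zero, ZMod.val_eq_zero] at h
    exact ⟨(1, 0, 0, 1), by simp [h]⟩
  have hg : 0 < Nat.gcd a.val a'.val := by
    rw [Nat.gcd_pos_iff]; omega
  obtain ⟨α, hα⟩ := Nat.gcd_dvd_left a.val a'.val
  obtain ⟨β, hβ⟩ := Nat.gcd_dvd_right a.val a'.val
  have hb := Nat.gcd_eq_gcd_ab a.val a'.val
  set g := Nat.gcd a.val a'.val
  set x := Nat.gcdA a.val a'.val
  set y := Nat.gcdB a.val a'.val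
  have ha : a = ((g * α : ℕ) : ZMod m) := by rw [← hα, ZMod.natCast_zmod_val]
  have ha' : a' = ((g * β : ℕ) : ZMod m) := by rw [← hβ, ZMod.natCast_zmod_val]
  have h₁ : (x * α + y * β : ℤ) = 1 := by
    rw [hα, hβ] at hb
    have h₂ : (g : ℤ) ≠ 0 := by exact_mod_cast hg.ne'
    apply mul_left_cancel₀ h₂
    push_cast at hb
    linear_combination -hb
  refine ⟨((x : ZMod m), (y : ZMod m), -(β : ZMod m), (α : ZMod m)), ?_, ?_⟩
  · simp only [ha, ha']; push_cast; ring
  · have := congrArg (Int.cast (R := ZMod m)) h₁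
    push_cast at this
    linear_combination this

/-- For `g = gcd(a, m)` take `e = m / g`: then `e d = 0` means that `g` divides `d`, and `g` is a
multiple of `a` modulo `m` by Bézout. Solvability of `a x = d` thus becomes a single linear
condition on `d`. -/
theorem ZMod.exists_annihilator {m : ℕ} [NeZero m] (a : ZMod m) :
    ∃ e : ZMod m, e * a = 0 ∧ ∀ d, e * d = 0 → ∃ x, a * x = d := by
  obtain ⟨α, hα⟩ := Nat.gcd_dvd_left a.val m
  obtain ⟨μ, hμ⟩ := Nat.gcd_dvd_right a.val m
  have hb := Nat.gcd_eq_gcd_ab a.val m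
  have hg : 0 < Nat.gcd a.val m := Nat.gcd_pos_of_pos_right _ (NeZero.pos m)
  set g := Nat.gcd a.val m
  have hμ0 : μ ≠ 0 := by rintro rfl; exact NeZero.ne m (by simpa using hμ)
  refine ⟨(μ : ZMod m), ?_, fun d hd => ?_⟩
  · have : (μ : ZMod m) * a = ((m * α : ℕ) : ZMod m) := by
      conv_lhs => rw [← ZMod.natCast_zmod_val a, hα]
      rw [← Nat.cast_mul]
      congr 1
      conv_rhs => rw [hμ]
      ring
    rw [this]; simp
  · have h₁ : m ∣ μ * d.val := by
      rw [← ZMod.natCast_eq_zero_iff]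
      simpa using hd
    conv_lhs at h₁ => rw [hμ]
    rw [mul_comm g μ] at h₁
    obtain ⟨k, hk⟩ := Nat.dvd_of_mul_dvd_mul_left (Nat.pos_of_ne_zero hμ0) h₁
    refine ⟨(Nat.gcdA a.val m : ZMod m) * k, ?_⟩
    have h₂ := congrArg (Int.cast (R := ZMod m)) hb
    push_cast at h₂
    rw [ZMod.natCast_self, zero_mul, add_zero, ZMod.natCast_zmod_val] at h₂
    have h₃ : d = (g : ZMod m) * k := by
      rw [← Nat.cast_mul, ← hk, ZMod.natCast_zmod_val]
    rw [h₃, h₂]; ring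

section elimination
variable {m : ℕ}

/-- The value of the linear form `R` at `x`. -/
def dot (R x : List (ZMod m)) : ZMod m := (List.zipWith (· * ·) R x).sum

/-- The linear combination of two rows. -/
def rowComb (u v : ZMod m) (R R' : List (ZMod m)) : List (ZMod m) :=
  List.zipWith (fun x y => u * x + v * y) R R'

theorem length_rowComb {u v : ZMod m} {R R' : List (ZMod m)} (h : R.length = R'.length) :
    (rowComb u v R R').length = R.length := by
  simp [rowComb, h]

theorem dot_cons (a y : ZMod m) (R x : List (ZMod m)) :
    dot (a :: R) (y :: x) = a * y + dot R x := by
  simp [dot]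

theorem dot_rowComb (u v : ZMod m) {R R' : List (ZMod m)} (x : List (ZMod m))
    (h : R.length = R'.length) : dot (rowComb u v R R') x = u * dot R x + v * dot R' x := by
  induction R generalizing R' x with
  | nil =>
      obtain rfl : R' = [] := by simpa using h.symm
      simp [dot, rowComb]
  | cons a R ih =>
      rcases R' with _ | ⟨a', R'⟩
      · simp at h
      · rcases x with _ | ⟨y, x⟩
        · simp [dot]
        · have := ih x (R' := R') (by simpa using h)
          simp only [rowComb, List.zipWith_cons_cons, dot_cons] at this ⊢
          rw [this]; ring

theorem dot_map_mul (u : ZMod m) (R x : List (ZMod m)) :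
    dot (R.map (u * ·)) x = u * dot R x := by
  induction R generalizing x with
  | nil => simp [dot]
  | cons a R ih =>
      rcases x with _ | ⟨y, x⟩
      · simp [dot]
      · rw [List.map_cons, dot_cons, dot_cons, ih]; ring

variable [NeZero m]

/-- A unimodular transformation that maps the second of two leading coefficients to `0`. -/
noncomputable def bezout (a a' : ZMod m) : ZMod m × ZMod m × ZMod m × ZMod m :=
  (ZMod.exists_bezout a a').choose

/-- A generator of the annihilator. -/
noncomputable def annihilator (a : ZMod m) : ZMod m := (ZMod.exists_annihilator a).choose

/-- One step of the elimination of the first unknown: the pivot row and the list of rows without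
the first unknown are updated by a further row. -/
noncomputable def elimStep (s : List (ZMod m) × List (List (ZMod m))) (R : List (ZMod m)) :
    List (ZMod m) × List (List (ZMod m)) :=
  let t := bezout (s.1.headD 0) (R.headD 0)
  (rowComb t.1 t.2.1 s.1 R, (rowComb t.2.2.1 t.2.2.2 s.1 R).tail :: s.2)

/-- The last row obtained in the elimination of the first unknown. -/
noncomputable def elimLast (piv : List (ZMod m)) : List (ZMod m) :=
  (piv.map (annihilator (piv.headD 0) * ·)).tail

theorem length_elimLast (piv : List (ZMod m)) : (elimLast piv).length = piv.length - 1 := by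
  simp [elimLast]

/-- Elimination of the first unknown. -/
noncomputable def elimCol (rows : List (List (ZMod m))) : List (List (ZMod m)) :=
  match rows with
  | [] => []
  | R :: _ => elimLast (rows.foldl elimStep (R, [])).1 :: (rows.foldl elimStep (R, [])).2

/-- The transformation of the two rows has determinant `1`, so no solutions are gained or lost; the
second new row has leading coefficient `0`, so that entry can be dropped. -/
theorem elimStep_spec {n : ℕ} {s : List (ZMod m) × List (List (ZMod m))} {R : List (ZMod m)}
    (hs : s.1.length = n + 1) (hR : R.length = n + 1) (y : ZMod m) (x : List (ZMod m)) :
    (dot (elimStep s R).1 (y :: x) = 0 ∧ ∀ Q ∈ (elimStep s R).2, dot Q x = 0) ↔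
      (dot s.1 (y :: x) = 0 ∧ ∀ Q ∈ s.2, dot Q x = 0) ∧ dot R (y :: x) = 0 := by
  obtain ⟨h₁, h₂⟩ := (ZMod.exists_bezout (s.1.headD 0) (R.headD 0)).choose_spec
  obtain ⟨piv, out⟩ := s
  simp only at hs
  have hl : piv.length = R.length := hs.trans hR.symm
  simp only [elimStep, List.forall_mem_cons]
  change (bezout (piv.headD 0) (R.headD 0)).2.2.1 * _ +
    (bezout (piv.headD 0) (R.headD 0)).2.2.2 * _ = 0 at h₁
  change (bezout (piv.headD 0) (R.headD 0)).1 * (bezout (piv.headD 0) (R.headD 0)).2.2.2 -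
    (bezout (piv.headD 0) (R.headD 0)).2.1 * (bezout (piv.headD 0) (R.headD 0)).2.2.1 = 1 at h₂
  generalize bezout (piv.headD 0) (R.headD 0) = t at h₁ h₂
  have h₃ : dot (rowComb t.2.2.1 t.2.2.2 piv R).tail x =
      dot (rowComb t.2.2.1 t.2.2.2 piv R) (y :: x) := by
    rcases piv with _ | ⟨a, piv⟩
    · simp at hs
    · rcases R with _ | ⟨a', R⟩
      · simp at hR
      · simp only [rowComb, List.zipWith_cons_cons, List.tail_cons, dot_cons]
        simp only [List.headD_cons] at h₁
        rw [h₁]; ring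
  rw [h₃, dot_rowComb _ _ _ hl, dot_rowComb _ _ _ hl]
  constructor
  -- The old rows are recovered with the inverse matrix.
  · rintro ⟨e₁, e₂, e₃⟩
    refine ⟨⟨?_, e₃⟩, ?_⟩
    · linear_combination t.2.2.2 * e₁ - t.2.1 * e₂ - dot piv (y :: x) * h₂
    · linear_combination t.1 * e₂ - t.2.2.1 * e₁ - dot R (y :: x) * h₂
  · rintro ⟨⟨e₁, e₃⟩, e₂⟩
    exact ⟨by rw [e₁, e₂]; ring, by rw [e₁, e₂]; ring, e₃⟩

theorem length_elimStep {n : ℕ} {s : List (ZMod m) × List (List (ZMod m))} {R : List (ZMod m)}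
    (hs : s.1.length = n + 1 ∧ ∀ Q ∈ s.2, Q.length = n) (hR : R.length = n + 1) :
    (elimStep s R).1.length = n + 1 ∧ ∀ Q ∈ (elimStep s R).2, Q.length = n := by
  simp only [elimStep, List.forall_mem_cons, List.length_tail]
  rw [length_rowComb (hs.1.trans hR.symm), length_rowComb (hs.1.trans hR.symm)]
  exact ⟨hs.1, by omega, hs.2⟩

theorem foldl_elimStep_spec {n : ℕ} (rows : List (List (ZMod m)))
    (s : List (ZMod m) × List (List (ZMod m))) (hs : s.1.length = n + 1 ∧ ∀ Q ∈ s.2, Q.length = n)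
    (hR : ∀ R ∈ rows, R.length = n + 1) :
    ((rows.foldl elimStep s).1.length = n + 1 ∧ ∀ Q ∈ (rows.foldl elimStep s).2, Q.length = n) ∧
    ∀ (y : ZMod m) (x : List (ZMod m)), (dot (rows.foldl elimStep s).1 (y :: x) = 0 ∧
      ∀ Q ∈ (rows.foldl elimStep s).2, dot Q x = 0) ↔
      (dot s.1 (y :: x) = 0 ∧ ∀ Q ∈ s.2, dot Q x = 0) ∧ ∀ R ∈ rows, dot R (y :: x) = 0 := by
  induction rows generalizing s with
  | nil => simpa using hs
  | cons R rows ih =>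
      rw [List.forall_mem_cons] at hR
      obtain ⟨h₁, h₂⟩ := ih (elimStep s R) (length_elimStep hs hR.1) hR.2
      refine ⟨h₁, fun y x => ?_⟩
      rw [List.foldl_cons, h₂, elimStep_spec hs.1 hR.1, List.forall_mem_cons, and_assoc]

/-- The pivot equation `a y + d = 0` can be solved for `y` exactly if the annihilator of `a` kills
`d`. -/
theorem elimLast_spec {n : ℕ} {piv : List (ZMod m)} (h : piv.length = n + 1)
    (x : List (ZMod m)) : dot (elimLast piv) x = 0 ↔ ∃ y, dot piv (y :: x) = 0 := by
  obtain ⟨h₁, h₂⟩ := (ZMod.exists_annihilator (piv.headD 0)).choose_spec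
  rcases piv with _ | ⟨a, piv⟩
  · simp at h
  change annihilator a * a = 0 at h₁
  change ∀ d, annihilator a * d = 0 → _ at h₂
  simp only [elimLast, List.headD_cons, List.map_cons, List.tail_cons, dot_cons, dot_map_mul] at *
  constructor
  · intro e
    obtain ⟨y, hy⟩ := h₂ _ e
    exact ⟨-y, by rw [← hy]; ring⟩
  · rintro ⟨y, hy⟩
    linear_combination annihilator a * hy - y * h₁

theorem elimCol_spec {n : ℕ} (rows : List (List (ZMod m))) (hR : ∀ R ∈ rows, R.length = n + 1) :
    (∀ R ∈ elimCol rows, R.length = n) ∧ ∀ x : List (ZMod m),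
      (∀ R ∈ elimCol rows, dot R x = 0) ↔ ∃ y, ∀ R ∈ rows, dot R (y :: x) = 0 := by
  rcases rows with _ | ⟨R, rows⟩
  · simp [elimCol]
  -- The row `R` is both the initial pivot and the first row folded in; the repetition does not
  -- change the solutions.
  obtain ⟨⟨h₁, h₂⟩, h₃⟩ := foldl_elimStep_spec (R :: rows) (R, []) ⟨hR R List.mem_cons_self, by simp⟩ hR
  simp only [elimCol, List.forall_mem_cons (a := elimLast _)]
  refine ⟨⟨by rw [length_elimLast, h₁]; rfl, h₂⟩, fun x => ?_⟩
  rw [elimLast_spec h₁, ← exists_and_right]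
  refine exists_congr fun y => ?_
  rw [h₃]
  simp only [List.forall_mem_cons, List.not_mem_nil, false_implies, implies_true, and_true]
  tauto

/-- Solvability of a system of linear equations modulo `m`: the rows list the coefficients and
the right-hand side. -/
noncomputable def eliminate {κ : Type*} (cols : List κ) (rows : List (List (ZMod m))) :
    List (List (ZMod m)) := cols.foldl (fun r _ => elimCol r) rows

/-- Appending `-1` to the solution turns the last column into the right-hand side. Once all unknowns
are eliminated, each row is a lone right-hand side that has to vanish. -/
theorem eliminate_spec {κ : Type*} (cols : List κ) (rows : List (List (ZMod m)))
    (hR : ∀ R ∈ rows, R.length = cols.length + 1) :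
    (∀ R ∈ eliminate cols rows, R.headD 0 = 0) ↔
      ∃ x : List (ZMod m), x.length = cols.length ∧ ∀ R ∈ rows, dot R (x ++ [-1]) = 0 := by
  induction cols generalizing rows with
  | nil =>
      have : ∀ R ∈ rows, R.headD 0 = 0 ↔ dot R [-1] = 0 := by
        intro R hr
        obtain ⟨a, rfl⟩ := List.length_eq_one_iff.1 (hR R hr)
        simp [dot]
      constructor
      · exact fun h => ⟨[], rfl, fun R hr => (this R hr).1 (h R hr)⟩
      · rintro ⟨x, hx, h⟩
        obtain rfl : x = [] := by simpa using hx
        exact fun R hr => (this R hr).2 (h R hr)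
  | cons c cols ih =>
      obtain ⟨h₁, h₂⟩ := elimCol_spec rows hR
      rw [eliminate, List.foldl_cons, ← eliminate, ih _ h₁]
      simp only [h₂]
      constructor
      · rintro ⟨x, hx, y, hy⟩
        exact ⟨y :: x, by simp [hx], hy⟩
      · rintro ⟨x, hx, h⟩
        rcases x with _ | ⟨y, x⟩
        · simp at hx
        · exact ⟨x, by simpa using hx, y, h⟩

end elimination

/-! ### The elimination in polynomial time -/

instance instEncZMod (m : ℕ) : Enc (ZMod m) := ⟨fun x => encNat x.val⟩

instance (m : ℕ) [NeZero m] : InjEnc (ZMod m) :=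
  ⟨fun _ _ h => ZMod.val_injective m (encNat_injective h)⟩

namespace PF

variable {α β γ : Type*} [Enc α] [Enc β] [Enc γ]

theorem headD {l : α → List β} (hl : PF l) (b : β) : PF fun a => (l a).headD b :=
  listCases (f := fun _ => b) (g := fun _ c _ => c) hl (const b) id.snd.fst (by simp +contextual)
    (by simp +contextual)

theorem listTail {l : α → List β} (hl : PF l) : PF fun a => (l a).tail :=
  listCases (f := fun _ => []) (g := fun _ _ t => t) hl (const []) id.snd.snd (by simp +contextual)
    (by simp +contextual)

theorem zip {l : α → List β} {l' : α → List γ} (hl : PF l) (hl' : PF l') :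
    PF fun a => (l a).zip (l' a) := by
  let step : List (β × γ) × List γ → β → List (β × γ) × List γ := fun s b =>
    match s.2 with
    | [] => s
    | c :: t => (s.1 ++ [(b, c)], t)
  have hstep : PF fun x : α × (List (β × γ) × List γ) × β => step x.2.1 x.2.2 := by
    refine listCases (l := fun x : α × (List (β × γ) × List γ) × β => x.2.1.2)
      (f := fun x => x.2.1) (g := fun x c t => (x.2.1.1 ++ [(x.2.2, c)], t)) id.snd.fst.snd
      id.snd.fst ((id.fst.snd.fst.fst.append ((id.fst.snd.snd.pair id.snd.fst).cons
      (const []))).pair id.snd.snd) ?_ ?_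
    · intro x hx; simp only [step, hx]
    · intro x c t hx; simp only [step, hx]
  have e : ∀ (v : List β) (u : List (β × γ)) (w : List γ),
      v.foldl step (u, w) = (u ++ v.zip w, w.drop v.length) := by
    intro v
    induction v with
    | nil => simp
    | cons b v ih =>
        intro u w
        rcases w with _ | ⟨c, w⟩
        · simp only [List.foldl_cons, step]
          rw [ih]; simp
        · simp only [List.foldl_cons, step]
          rw [ih]; simp
  have hz : ∀ (v : List β) (w : List γ),
      (enc (v.zip w)).length ≤ 2 * (enc v).length + (enc w).length := by
    intro v
    induction v with
    | nil => simp [enc_nil]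
    | cons b v ih =>
        rintro (_ | ⟨c, w⟩)
        · simp [enc_nil]
        · have := ih w
          rw [List.zip_cons_cons, length_enc_cons, length_enc_cons, length_enc_cons,
            length_enc_prod]
          omega
  refine (foldl (step := fun _ s b => step s b) (init := fun a => ([], l' a)) hl
    ((const []).pair hl') hstep ?_).fst.congr fun a => by rw [e]; simp
  obtain ⟨p, hp⟩ := hl.length_le
  obtain ⟨q, hq⟩ := hl'.length_le
  refine ⟨4 * p + 3 * q + 1, fun a v hv => ?_⟩
  have h₁ := length_enc_le_of_isPrefix hv
  have h₂ := length_enc_drop_le (l' a) v.length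
  have h₃ := hz v (l' a)
  have := hp a
  have := hq a
  rw [e, length_enc_prod, List.nil_append]
  simp only [Polynomial.eval_add, Polynomial.eval_mul, Polynomial.eval_ofNat,
    Polynomial.eval_one]
  omega

theorem rowComb {m : ℕ} [NeZero m] {u v : α → ZMod m} {R R' : α → List (ZMod m)} (hu : PF u)
    (hv : PF v) (hR : PF R) (hR' : PF R') : PF fun a => rowComb (u a) (v a) (R a) (R' a) := by
  have h : PF fun x : ZMod m × ZMod m × ZMod m × ZMod m => x.1 * x.2.2.1 + x.2.1 * x.2.2.2 :=
    of_finite _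
  refine (map (f := fun a (z : ZMod m × ZMod m) => u a * z.1 + v a * z.2) (hR.zip hR')
    (h.comp ((hu.comp id.fst).pair ((hv.comp id.fst).pair (id.snd.fst.pair id.snd.snd))))).congr
    fun a => ?_
  simp [PromiseCSP.rowComb, List.zip, List.map_zipWith]

end PF

theorem length_enc_rows_le {κ : ℕ} (hκ : ∀ x : ZMod m, (enc x).length ≤ κ)
    {rows : List (List (ZMod m))} {N B : ℕ} (hN : rows.length ≤ N) (hB : ∀ R ∈ rows, R.length ≤ B) :
    (enc rows).length ≤ N * (2 * (B * (2 * κ + 1)) + 1) :=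
  (length_enc_le_of_forall fun R hR => (length_enc_le_of_forall fun x _ => hκ x).trans
    (Nat.mul_le_mul_right _ (hB R hR))).trans (Nat.mul_le_mul_right _ hN)

section elimination
variable {m : ℕ} [NeZero m]

theorem exists_length_enc_le (m : ℕ) [NeZero m] : ∃ κ : ℕ, ∀ x : ZMod m, (enc x).length ≤ κ := by
  obtain ⟨κ, hκ⟩ := (Set.finite_range fun x : ZMod m => (enc x).length).bddAbove
  exact ⟨κ, fun x => hκ ⟨x, rfl⟩⟩

theorem foldl_elimStep_le {B : ℕ} (rows : List (List (ZMod m)))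
    (s : List (ZMod m) × List (List (ZMod m)))
    (hs : s.1.length ≤ B ∧ ∀ Q ∈ s.2, Q.length ≤ B) :
    (rows.foldl elimStep s).1.length ≤ B ∧ (∀ Q ∈ (rows.foldl elimStep s).2, Q.length ≤ B) ∧
      (rows.foldl elimStep s).2.length = s.2.length + rows.length := by
  induction rows generalizing s with
  | nil => simpa using hs
  | cons R rows ih =>
      obtain ⟨h₁, h₂, h₃⟩ := ih (elimStep s R) ⟨by simp [elimStep, rowComb, hs.1], by
        simp only [elimStep, List.forall_mem_cons]
        exact ⟨by simp [rowComb]; omega, hs.2⟩⟩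
      refine ⟨h₁, h₂, h₃.trans ?_⟩
      simp [elimStep]; omega

/-- Each unknown costs at most one additional row and no row grows. Since entries of `ZMod m` have
bounded size, all intermediate systems stay polynomial. -/
theorem elimCol_le {B : ℕ} (rows : List (List (ZMod m))) (hB : ∀ R ∈ rows, R.length ≤ B) :
    (elimCol rows).length ≤ rows.length + 1 ∧ ∀ R ∈ elimCol rows, R.length ≤ B := by
  rcases rows with _ | ⟨R, rows⟩
  · simp [elimCol]
  obtain ⟨h₁, h₂, h₃⟩ := foldl_elimStep_le (B := B) (R :: rows) (R, [])
    ⟨hB R List.mem_cons_self, by simp⟩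
  simp only [elimCol, List.forall_mem_cons (a := elimLast _), List.length_cons (as := Prod.snd _),
    h₃]
  exact ⟨by simp, by rw [length_elimLast]; omega, h₂⟩

theorem pf_elimStep :
    PF fun x : (List (ZMod m) × List (List (ZMod m))) × List (ZMod m) => elimStep x.1 x.2 := by
  have hb : PF fun x : ZMod m × ZMod m => bezout x.1 x.2 := PF.of_finite _
  have hp : PF fun x : (List (ZMod m) × List (List (ZMod m))) × List (ZMod m) => x.1.1 :=
    PF.id.fst.fst
  have hr : PF fun x : (List (ZMod m) × List (List (ZMod m))) × List (ZMod m) => x.2 := PF.id.snd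
  have ht : PF fun x : (List (ZMod m) × List (List (ZMod m))) × List (ZMod m) =>
      bezout (x.1.1.headD 0) (x.2.headD 0) := PF.comp₂ (g := bezout) hb (hp.headD 0) (hr.headD 0)
  have h₁ := PF.rowComb ht.fst ht.snd.fst hp hr
  have h₂ := PF.rowComb ht.snd.snd.fst ht.snd.snd.snd hp hr
  exact (h₁.pair (h₂.listTail.cons PF.id.fst.snd)).congr fun x => rfl

theorem pf_elimCol : PF (elimCol (m := m)) := by
  have hstep := pf_elimStep (m := m) |>.comp
    (PF.id (α := List (List (ZMod m)) × (List (ZMod m) × List (List (ZMod m))) × List (ZMod m))).snd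
  have hfold : PF fun rows : List (List (ZMod m)) => rows.foldl elimStep (rows.headD [], []) := by
    refine PF.foldl (step := fun _ s R => elimStep s R)
      (init := fun rows : List (List (ZMod m)) => (rows.headD [], [])) PF.id
      ((PF.id.headD []).pair (PF.const [])) hstep ?_
    obtain ⟨κ, hκ⟩ := exists_length_enc_le m
    refine ⟨2 * (.X * (2 * .C κ + 1)) + 1 + .X * (2 * (.X * (2 * .C κ + 1)) + 1),
      fun rows l' hl' => ?_⟩
    have hB : (rows.headD []).length ≤ (enc rows).length := by
      rcases rows with _ | ⟨R, rows⟩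
      · simp
      · have := length_le_length_enc R
        have := length_enc_le_of_mem (a := R) (l := R :: rows) List.mem_cons_self
        simp only [List.headD_cons]
        omega
    obtain ⟨h₁, h₂, h₃⟩ := foldl_elimStep_le (B := (enc rows).length) l' (rows.headD [], [])
      ⟨hB, by simp⟩
    have h₄ := length_enc_rows_le hκ (N := (enc rows).length) (by
      rw [h₃]
      simpa using hl'.length_le.trans (length_le_length_enc rows)) h₂
    have h₅ := (length_enc_le_of_forall fun x (_ : x ∈ (l'.foldl elimStep (rows.headD [], [])).1) =>
      hκ x).trans (Nat.mul_le_mul_right _ h₁)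
    rw [← Prod.mk.eta (p := l'.foldl elimStep (rows.headD [], [])), length_enc_prod]
    simp only [Polynomial.eval_add, Polynomial.eval_mul, Polynomial.eval_ofNat,
      Polynomial.eval_one, Polynomial.eval_X, Polynomial.eval_C]
    omega
  have hlast : PF (elimLast (m := m)) := by
    have h₁ : PF fun x : ZMod m × ZMod m => annihilator x.1 * x.2 := PF.of_finite _
    have h₂ : PF fun x : List (ZMod m) × ZMod m => annihilator (x.1.headD 0) * x.2 :=
      PF.comp₂ (g := fun a x => annihilator a * x) h₁ (PF.id.fst.headD 0) PF.id.snd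
    exact (PF.map (f := fun (piv : List (ZMod m)) x => annihilator (piv.headD 0) * x) PF.id h₂).listTail
  refine PF.listCases (l := fun rows => rows) (f := fun _ => []) (g := fun rows _ _ =>
    elimLast (rows.foldl elimStep (rows.headD [], [])).1 ::
      (rows.foldl elimStep (rows.headD [], [])).2) PF.id (PF.const [])
    ((hlast.comp (hfold.comp PF.id.fst).fst).cons (hfold.comp PF.id.fst).snd) ?_ ?_
  · rintro _ rfl; rfl
  · rintro _ R rows rfl; rfl

theorem eliminate_le {κ : Type*} {B : ℕ} (cols : List κ) (rows : List (List (ZMod m)))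
    (hB : ∀ R ∈ rows, R.length ≤ B) : (eliminate cols rows).length ≤ rows.length + cols.length ∧
      ∀ R ∈ eliminate cols rows, R.length ≤ B := by
  induction cols generalizing rows with
  | nil => exact ⟨le_rfl, hB⟩
  | cons c cols ih =>
      obtain ⟨h₁, h₂⟩ := elimCol_le rows hB
      obtain ⟨h₃, h₄⟩ := ih _ h₂
      exact ⟨h₃.trans (by simp; omega), h₄⟩

theorem PF.eliminate {α β : Type*} [Enc α] [Enc β] {cols : α → List β}
    {rows : α → List (List (ZMod m))} (hc : PF cols) (hr : PF rows) :
    PF fun a => eliminate (cols a) (rows a) := by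
  refine PF.foldl (step := fun _ r _ => elimCol r) hc hr (pf_elimCol.comp PF.id.snd.fst) ?_
  obtain ⟨κ, hκ⟩ := exists_length_enc_le m
  obtain ⟨p, hp⟩ := hr.length_le
  obtain ⟨q, hq⟩ := hc.length_le
  refine ⟨(p + q) * (2 * (p * (2 * .C κ + 1)) + 1), fun a l' hl' => ?_⟩
  obtain ⟨h₁, h₂⟩ := eliminate_le (B := p.eval (enc a).length) l' (rows a) fun R hR =>
    (length_le_length_enc R).trans ((length_enc_le_of_mem hR).trans (hp a))
  have h₃ : l'.length ≤ q.eval (enc a).length :=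
    hl'.length_le.trans ((length_le_length_enc _).trans (hq a))
  have h₄ := (length_le_length_enc (rows a)).trans (hp a)
  have h₅ := length_enc_rows_le hκ (N := p.eval (enc a).length + q.eval (enc a).length)
    (by omega) h₂
  simp only [Polynomial.eval_add, Polynomial.eval_mul, Polynomial.eval_ofNat,
    Polynomial.eval_one, Polynomial.eval_C]
  exact h₅

end elimination

/-! ### Rounding of fractional solutions -/

/-- For all `p` except one, `n * w p` is rounded to a number in the prescribed residue class, with
error at most `m`. The remaining `p₀` absorbs the difference to `n`; its residue is then correct
because of the congruence assumed for the sum. -/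
theorem exists_counts {τ : Type*} (T : Finset τ) (w : τ → ℝ) (R : τ → ℤ) {m n : ℕ} (hm : 0 < m)
    (hw : ∀ p ∈ T, 0 ≤ w p) (hw₁ : ∑ p ∈ T, w p = 1) (hR : (m : ℤ) ∣ n - ∑ p ∈ T, R p)
    (hn : T.card * T.card * m ≤ n) : ∃ C : τ → ℕ, ∑ p ∈ T, C p = n ∧
      ∀ p ∈ T, (m : ℤ) ∣ C p - R p ∧ |(C p : ℝ) - n * w p| ≤ T.card * m := by
  classical
  have hT : T.Nonempty := by
    by_contra h
    rw [Finset.not_nonempty_iff_eq_empty] at h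
    simp [h] at hw₁
  have hc : (0 : ℝ) < T.card := by exact_mod_cast hT.card_pos
  have hc₁ : (1 : ℝ) ≤ T.card := by exact_mod_cast hT.card_pos
  have hm' : (0 : ℝ) < m := by exact_mod_cast hm
  -- Some weight is at least the average. Its share of `n` is at least `T.card * m`, which exceeds
  -- the accumulated rounding error, so its count stays nonnegative.
  obtain ⟨p₀, hp₀, hwp⟩ : ∃ p ∈ T, (T.card : ℝ)⁻¹ ≤ w p := by
    apply Finset.exists_le_of_sum_le hT
    rw [hw₁, Finset.sum_const, nsmul_eq_mul, mul_inv_cancel₀ hc.ne']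
  let D : τ → ℤ := fun p => m * ⌊n * w p / m⌋ + R p % m
  have hD : ∀ p ∈ T, 0 ≤ D p ∧ (m : ℤ) ∣ D p - R p ∧ |(D p : ℝ) - n * w p| ≤ m := by
    intro p hp
    have h₁ : 0 ≤ R p % m := Int.emod_nonneg _ (by exact_mod_cast hm.ne')
    have h₂ : R p % m < m := Int.emod_lt_of_pos _ (by exact_mod_cast hm)
    have h₁' : (0 : ℝ) ≤ ((R p % m : ℤ) : ℝ) := by exact_mod_cast h₁
    have h₂' : ((R p % m : ℤ) : ℝ) < m := by exact_mod_cast h₂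
    have h₃ : 0 ≤ ⌊n * w p / m⌋ := by
      have := hw p hp
      positivity
    have h₄ : (m : ℝ) * ⌊n * w p / m⌋ ≤ n * w p := by
      have := Int.floor_le (n * w p / m)
      rw [le_div_iff₀ hm'] at this
      linarith
    have h₅ : n * w p < (m : ℝ) * ⌊n * w p / m⌋ + m := by
      have := Int.lt_floor_add_one (n * w p / m)
      rw [div_lt_iff₀ hm'] at this
      linarith
    refine ⟨by positivity, ?_, ?_⟩
    · have := Int.emod_add_mul_ediv (R p) m
      refine ⟨⌊n * w p / m⌋ - R p / m, ?_⟩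
      simp only [D]
      linear_combination this
    · simp only [D]
      push_cast at h₁' h₂' ⊢
      rw [abs_le]
      constructor <;> linarith
  let F : ℤ := n - ∑ p ∈ T.erase p₀, D p
  have hF : (F : ℝ) - n * w p₀ = ∑ p ∈ T.erase p₀, (n * w p - D p) := by
    have h := Finset.add_sum_erase T w hp₀
    rw [hw₁] at h
    simp only [F, Finset.sum_sub_distrib, ← Finset.mul_sum]
    push_cast
    linear_combination -(n : ℝ) * h
  have hF₁ : |(F : ℝ) - n * w p₀| ≤ (T.card - 1) * m := by
    rw [hF]
    refine (Finset.abs_sum_le_sum_abs _ _).trans ?_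
    refine (Finset.sum_le_card_nsmul _ _ (m : ℝ) fun p hp => ?_).trans ?_
    · rw [abs_sub_comm]
      exact (hD p (Finset.mem_of_mem_erase hp)).2.2
    · rw [Finset.card_erase_of_mem hp₀, nsmul_eq_mul, Nat.cast_sub hT.card_pos]
      simp
  have hF₂ : (m : ℤ) ∣ F - R p₀ := by
    have h := Finset.add_sum_erase T R hp₀
    have h₁ : F - R p₀ = (n - ∑ p ∈ T, R p) - ∑ p ∈ T.erase p₀, (D p - R p) := by
      simp only [F, Finset.sum_sub_distrib]
      linear_combination -h
    rw [h₁]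
    exact dvd_sub hR (Finset.dvd_sum fun p hp => (hD p (Finset.mem_of_mem_erase hp)).2.1)
  have hF₀ : 0 ≤ F := by
    have h₁ : (T.card : ℝ) * m ≤ n * w p₀ := by
      have hn' : (T.card : ℝ) * T.card * m ≤ n := by exact_mod_cast hn
      calc (T.card : ℝ) * m = (T.card * T.card * m) * (T.card : ℝ)⁻¹ := by field_simp
        _ ≤ n * w p₀ := by gcongr
    have h₂ := (abs_le.1 hF₁).1
    have : (0 : ℝ) ≤ F := by nlinarith
    exact_mod_cast this
  have hG : ∀ p ∈ T, 0 ≤ Function.update D p₀ F p ∧ (m : ℤ) ∣ Function.update D p₀ F p - R p ∧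
      |((Function.update D p₀ F p : ℤ) : ℝ) - n * w p| ≤ T.card * m := by
    intro p hp
    by_cases h : p = p₀
    · subst h
      rw [Function.update_self]
      exact ⟨hF₀, hF₂, hF₁.trans (by nlinarith)⟩
    · rw [Function.update_of_ne h]
      obtain ⟨h₁, h₂, h₃⟩ := hD p hp
      exact ⟨h₁, h₂, h₃.trans (by nlinarith)⟩
  refine ⟨fun p => (Function.update D p₀ F p).toNat, ?_, fun p hp => ?_⟩
  · zify
    rw [Finset.sum_congr rfl fun p hp => Int.toNat_of_nonneg (hG p hp).1,
      ← Finset.add_sum_erase T _ hp₀, Function.update_self,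
      Finset.sum_congr rfl fun p hp => Function.update_of_ne (Finset.ne_of_mem_erase hp) _ _]
    simp [F]
  · obtain ⟨h₁, h₂, h₃⟩ := hG p hp
    have h₄ : (((Function.update D p₀ F p).toNat : ℤ)) = Function.update D p₀ F p :=
      Int.toNat_of_nonneg h₁
    refine ⟨by rwa [h₄], ?_⟩
    rw [← Int.cast_natCast, h₄]
    exact h₃

/-- Block `j` has as many coordinates as there are slots in the disjoint union of the `Fin (C j p)`;
any bijection between them is such an assignment. -/
theorem exists_assignment {b L : ℕ} {τ : Type*} [DecidableEq τ] (blk : Fin L → Fin b) (T : Finset τ)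
    (C : Fin b → τ → ℕ) (h : ∀ j, ∑ p ∈ T, C j p = blockSize blk j) :
    ∃ X : Fin L → τ, (∀ l, X l ∈ T) ∧
      ∀ j, ∀ p ∈ T, (Finset.univ.filter fun l => blk l = j ∧ X l = p).card = C j p := by
  have hcard : ∀ j, Fintype.card {l // blk l = j} = Fintype.card (Σ p : T, Fin (C j p)) := by
    intro j
    rw [Fintype.card_sigma, Fintype.card_subtype]
    simp only [Fintype.card_fin]
    rw [Finset.sum_coe_sort T (fun p => C j p), h]
    rfl
  have e := fun j => Fintype.equivOfCardEq (hcard j)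
  refine ⟨fun l => (e (blk l) ⟨l, rfl⟩).1, fun l => (e (blk l) ⟨l, rfl⟩).1.2, fun j p hp => ?_⟩
  symm
  rw [← Finset.card_fin (C j p)]
  -- The bijection is indexed by `blk l`; this transports it along `blk l = j`.
  have hX : ∀ j (y : {l // blk l = j}), ((e (blk y.1) ⟨y.1, rfl⟩).1 : τ) = (e j y).1 := by
    rintro j ⟨l, rfl⟩; rfl
  refine Finset.card_bij (fun a _ => ((e j).symm ⟨⟨p, hp⟩, a⟩).1) ?_ ?_ ?_
  · intro a _
    simp only [Finset.mem_filter, Finset.mem_univ, true_and]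
    refine ⟨((e j).symm ⟨⟨p, hp⟩, a⟩).2, ?_⟩
    rw [hX]; simp
  · intro a _ a' _ haa
    have := (e j).symm.injective (Subtype.ext haa)
    simpa using this
  · intro l hl
    simp only [Finset.mem_filter, Finset.mem_univ, true_and] at hl
    obtain ⟨rfl, hl⟩ := hl
    subst hl
    exact ⟨(e (blk l) ⟨l, rfl⟩).2, Finset.mem_univ _, by
      rw [show (⟨⟨((e (blk l) ⟨l, rfl⟩).1 : τ), hp⟩, (e (blk l) ⟨l, rfl⟩).2⟩ :
        Σ p : T, Fin (C (blk l) p)) = e (blk l) ⟨l, rfl⟩ from rfl, Equiv.symm_apply_apply]⟩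

theorem ham_eq_sum {b L a : ℕ} {blk : Fin L → Fin b} {T : Finset (Fin a → Bool)}
    {X : Fin L → Fin a → Bool} (hX : ∀ l, X l ∈ T) {C : (Fin a → Bool) → ℕ} {j : Fin b}
    (hC : ∀ p ∈ T, (Finset.univ.filter fun l => blk l = j ∧ X l = p).card = C p) (k : Fin a) :
    ham blk (fun l => X l k) j = ∑ p ∈ T.filter (fun p => p k = true), C p := by
  rw [ham, Finset.card_eq_sum_card_fiberwise (f := X) (t := T.filter fun p => p k = true)]
  · refine Finset.sum_congr rfl fun p hp => ?_
    rw [Finset.mem_filter] at hp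
    rw [← hC p hp.1, Finset.filter_filter]
    congr 1
    ext l
    simp only [Finset.mem_filter, Finset.mem_univ, true_and]
    constructor
    · tauto
    · rintro ⟨h₁, rfl⟩; exact ⟨⟨h₁, hp.2⟩, rfl⟩
  · intro l hl
    simp only [Finset.coe_filter, Finset.mem_univ, true_and, Set.mem_ofPred_eq] at hl ⊢
    exact ⟨hX l, hl.2⟩

/-! ### Stability of regions and a common modulus. -/

section regions
variable {b : ℕ} {A : Fin b → Subring ℝ} {S : Type*} {Part : cube A → S}

theorem exists_cube_dist_lt (hdense : ∀ j, Dense (A j : Set ℝ)) {z : Fin b → ℝ}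
    (hz : ∀ j, 0 ≤ z j ∧ z j ≤ 1) {δ : ℝ} (hδ : 0 < δ) :
    ∃ y : cube A, dist z (y : Fin b → ℝ) < δ := by
  have h : ∀ j, ∃ a ∈ A j, 0 ≤ a ∧ a ≤ 1 ∧ dist (z j) a < δ := by
    intro j
    obtain ⟨h₀, h₁⟩ := hz j
    obtain ⟨a, ha, ha'⟩ := (hdense j).exists_between
      (show max 0 (z j - δ) < min 1 (z j + δ) by
        rw [max_lt_iff, lt_min_iff, lt_min_iff]
        exact ⟨⟨one_pos, by linarith⟩, by linarith, by linarith⟩)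
    simp only [Set.mem_Ioo, max_lt_iff, lt_min_iff] at ha'
    refine ⟨a, ha, ha'.1.1.le, ha'.2.1.le, ?_⟩
    rw [Real.dist_eq, abs_lt]
    constructor <;> linarith [ha'.1.2, ha'.2.2]
  choose a ha using h
  exact ⟨⟨a, fun j => ⟨(ha j).1, (ha j).2.1, (ha j).2.2.1⟩⟩,
    (dist_pi_lt_iff hδ).2 fun j => (ha j).2.2.2⟩

/-- The value picked by `extPart` is determined because the points of `cube A` are dense in the unit
cube: one of them lies both in the ball belonging to the picked value and in the ball around `x`
where `Part` is constant. -/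
theorem extPart_eq_some (hdense : ∀ j, Dense (A j : Set ℝ)) {x : cube A} {ε : ℝ}
    (hε : ∀ y : cube A, dist (y : Fin b → ℝ) x < ε → Part y = Part x) {z : Fin b → ℝ}
    (hz : ∀ j, 0 ≤ z j ∧ z j ≤ 1) (hd : dist z x < ε) : extPart Part z = some (Part x) := by
  have h : ∃ k : S, ∃ δ > 0, ∀ y : cube A, dist z (y : Fin b → ℝ) < δ → Part y = k := by
    refine ⟨Part x, ε - dist z x, by linarith, fun y hy => hε y ?_⟩
    have := dist_triangle_left (y : Fin b → ℝ) x z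
    linarith
  rw [extPart, dif_pos h]
  obtain ⟨δ, hδ, hk⟩ := h.choose_spec
  obtain ⟨y, hy⟩ := exists_cube_dist_lt hdense hz (lt_min hδ (sub_pos.2 hd))
  rw [lt_min_iff] at hy
  rw [← hk y hy.1]
  congr 1
  apply hε
  have := dist_triangle_left (y : Fin b → ℝ) x z
  linarith [hy.2]

/-- The quotient ring depends on the region, so the region cannot be rewritten in place; the option
is generalized first. -/
theorem regPer_eq {E : Type*} {J : S → Ideal (Fin b → ℤ)}
    {M : (k : S) → ((Fin b → ℤ) ⧸ J k) → E} {L : ℕ} {blk : Fin L → Fin b}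
    (hblk : Admissible Part blk) {x : Fin L → Bool} {k : S}
    (h : extPart Part (fun j => (ham blk x j : ℝ) / (blockSize blk j : ℝ)) = some k) :
    regPer Part J M blk hblk x = M k (Ideal.Quotient.mk (J k) fun j => (ham blk x j : ℤ)) := by
  have key : ∀ (o : Option S) (ho : o.isSome), o = some k →
      M (o.get ho) (Ideal.Quotient.mk (J (o.get ho)) fun j => (ham blk x j : ℤ)) =
        M k (Ideal.Quotient.mk (J k) fun j => (ham blk x j : ℤ)) := by
    rintro o ho rfl; rfl
  exact key _ _ h

/-- A finite group is killed by its order, so the product of the orders of the quotients works for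
all `k`. -/
theorem exists_modulus {s : ℕ} (J : Fin s → Ideal (Fin b → ℤ))
    (hJ : ∀ k, Finite ((Fin b → ℤ) ⧸ J k)) : ∃ m : ℕ, 0 < m ∧
      ∀ k, ∀ u : Fin b → ℤ, (∀ j, (m : ℤ) ∣ u j) → u ∈ J k := by
  refine ⟨∏ k, Nat.card ((Fin b → ℤ) ⧸ J k), Finset.prod_pos fun k _ => Nat.card_pos,
    fun k u hu => ?_⟩
  have h : ∀ j, ((Nat.card ((Fin b → ℤ) ⧸ J k) : ℕ) : ℤ) ∣ u j := fun j =>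
    (Int.natCast_dvd_natCast.2 (Finset.dvd_prod_of_mem _ (Finset.mem_univ k))).trans (hu j)
  choose v hv using h
  have : u = Nat.card ((Fin b → ℤ) ⧸ J k) • v := by
    funext j
    simp [hv j]
  rw [this, ← Ideal.Quotient.eq_zero_iff_mem, map_nsmul]
  exact card_nsmul_eq_zero'

end regions

/-! ### From real and modular weights to an assignment over `E`. -/

open Classical in
/-- The tuples of the relation `P i`. -/
noncomputable def PromiseTemplate.tuples {E : Type*} {φ : Bool → E}
    (Γ : PromiseTemplate Bool E φ) (i : Fin Γ.size) : Finset (Fin (Γ.ar i) → Bool) :=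
  Finset.univ.filter (· ∈ Γ.P i)

theorem PromiseTemplate.mem_tuples {E : Type*} {φ : Bool → E} {Γ : PromiseTemplate Bool E φ}
    {i : Fin Γ.size} {p : Fin (Γ.ar i) → Bool} : p ∈ Γ.tuples i ↔ p ∈ Γ.P i := by
  simp [tuples]

theorem dvd_sub_of_cast_eq {m : ℕ} {x y : ℤ} (h : (x : ZMod m) = y) : (m : ℤ) ∣ x - y := by
  rw [← ZMod.intCast_zmod_eq_zero_iff_dvd]
  simp [h]

/-- Weights of the tuples of each clause that are consistent over all clauses, in the rings `A j`
and modulo `m`, give an assignment over `E`. -/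
theorem satisfiable_of_weights {b : ℕ} {A : Fin b → Subring ℝ}
    (hdense : ∀ j, Dense (A j : Set ℝ)) {s : ℕ} {Part : cube A → Fin s}
    (hPart : IsOpenPartition Part) {E : Type*} {J : Fin s → Ideal (Fin b → ℤ)}
    {M : (k : Fin s) → ((Fin b → ℤ) ⧸ J k) → E} {φ : Bool → E} {Γ : PromiseTemplate Bool E φ}
    (hpol : ∀ ℓ : ℕ, 0 < ℓ → ∃ (L : ℕ) (blk : Fin L → Fin b) (hblk : Admissible Part blk),
      (∀ j, ℓ ≤ blockSize blk j) ∧ Γ.IsPolymorphism (regPer Part J M blk hblk))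
    {m : ℕ} [NeZero m] (hm : ∀ k, ∀ u : Fin b → ℤ, (∀ j, (m : ℤ) ∣ u j) → u ∈ J k)
    (Ψ : Formula Γ.ar) (x : Fin Ψ.numVars → cube A)
    (w : Fin b → (cl : Σ i : Fin Γ.size, Fin (Γ.ar i) → Fin Ψ.numVars) →
      (Fin (Γ.ar cl.1) → Bool) → ℝ)
    (hw : ∀ j, ∀ cl ∈ Ψ.clauses, (∀ p ∈ Γ.tuples cl.1, 0 ≤ w j cl p) ∧
      ∑ p ∈ Γ.tuples cl.1, w j cl p = 1 ∧
      ∀ k, ∑ p ∈ (Γ.tuples cl.1).filter (fun p => p k = true), w j cl p = (x (cl.2 k)).1 j)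
    (r : (cl : Σ i : Fin Γ.size, Fin (Γ.ar i) → Fin Ψ.numVars) →
      (Fin (Γ.ar cl.1) → Bool) → ZMod m) (ρ : Fin Ψ.numVars → ZMod m)
    (hr : ∀ cl ∈ Ψ.clauses, ∑ p ∈ Γ.tuples cl.1, r cl p = 1 ∧
      ∀ k, ∑ p ∈ (Γ.tuples cl.1).filter (fun p => p k = true), r cl p = ρ (cl.2 k)) :
    Ψ.Satisfiable Γ.Q := by
  choose ε hε₀ hε using fun v => hPart (x v)
  set a : ℕ := ∑ i, (Γ.tuples i).card
  have ha : ∀ i, (Γ.tuples i).card ≤ a := fun i =>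
    Finset.single_le_sum (f := fun i => (Γ.tuples i).card) (fun _ _ => Nat.zero_le _)
      (Finset.mem_univ i)
  -- The first bound is what `exists_counts` needs. The second controls the marginals: at most `a`
  -- counts, each off by at most `a * m`, are divided by a block size of at least `ℓ`.
  obtain ⟨ℓ, hℓ₀, hℓ, hℓε⟩ : ∃ ℓ : ℕ, 0 < ℓ ∧ a * a * m ≤ ℓ ∧
      ∀ v, ((a * a * m : ℕ) : ℝ) / ℓ < ε v := by
    have h : ∀ᶠ ℓ : ℕ in Filter.atTop, ∀ v, ((a * a * m : ℕ) : ℝ) / ℓ < ε v :=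
      Filter.eventually_all.2 fun v =>
        (tendsto_const_div_atTop_nhds_zero_nat ((a * a * m : ℕ) : ℝ)).eventually_lt_const (hε₀ v)
    obtain ⟨ℓ, h₁, h₂, h₃⟩ := ((Filter.eventually_gt_atTop 0).and
      ((Filter.eventually_ge_atTop (a * a * m)).and h)).exists
    exact ⟨ℓ, h₁, h₂, h₃⟩
  obtain ⟨L, blk, hblk, hsize, -, hP⟩ := hpol ℓ hℓ₀
  -- The value of `v` uses only its region and its residue, so it is the same in all clauses.
  refine ⟨fun v => M (Part (x v)) (Ideal.Quotient.mk _ fun j =>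
    (blockSize blk j : ℤ) * ((ρ v).val : ℤ)), fun cl hcl => ?_⟩
  obtain ⟨hr₁, hr₂⟩ := hr cl hcl
  -- The prescribed residues are consistent: the modular weights sum to `1`, hence their multiples
  -- by the block size sum to the block size.
  have hcount := fun j => exists_counts (Γ.tuples cl.1) (w j cl)
    (fun p => (blockSize blk j : ℤ) * ((r cl p).val : ℤ)) (m := m) (n := blockSize blk j)
    (NeZero.pos m) (hw j cl hcl).1 (hw j cl hcl).2.1 (by
      apply dvd_sub_of_cast_eq
      push_cast
      simp only [ZMod.natCast_zmod_val]
      rw [← Finset.mul_sum, hr₁, mul_one])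
    ((Nat.mul_le_mul_right m (Nat.mul_le_mul (ha _) (ha _))).trans (hℓ.trans (hsize j)))
  choose C hC₁ hC₂ using hcount
  obtain ⟨X, hX, hXC⟩ := exists_assignment blk (Γ.tuples cl.1) C hC₁
  have hXP := hP cl.1 X fun l => PromiseTemplate.mem_tuples.1 (hX l)
  convert hXP using 1
  funext k
  symm
  have hham : ∀ j, ham blk (fun l => X l k) j =
      ∑ p ∈ (Γ.tuples cl.1).filter (fun p => p k = true), C j p := fun j =>
    ham_eq_sum hX (hXC j) k
  rw [regPer_eq hblk (extPart_eq_some hdense (hε (cl.2 k)) (fun j => ⟨by positivity, ?_⟩) ?_)]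
  · congr 1
    rw [Ideal.Quotient.eq]
    apply hm
    intro j
    apply dvd_sub_of_cast_eq
    push_cast
    rw [hham, Nat.cast_sum, ZMod.natCast_zmod_val, ← hr₂ k, Finset.mul_sum]
    refine Finset.sum_congr rfl fun p hp => ?_
    have := (hC₂ j p (Finset.mem_of_mem_filter p hp)).1
    rw [← ZMod.intCast_zmod_eq_zero_iff_dvd] at this
    push_cast at this
    rw [ZMod.natCast_zmod_val] at this
    linear_combination this
  · rw [dist_pi_lt_iff (hε₀ _)]
    intro j
    have hn : (0 : ℝ) < blockSize blk j := by exact_mod_cast hblk.pos j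
    have hℓ' : (0 : ℝ) < ℓ := by exact_mod_cast hℓ₀
    refine lt_of_le_of_lt ?_ (hℓε (cl.2 k))
    rw [Real.dist_eq, hham, ← (hw j cl hcl).2.2 k, Nat.cast_sum]
    have h₁ : (∑ p ∈ (Γ.tuples cl.1).filter (fun p => p k = true), (C j p : ℝ)) / blockSize blk j -
        ∑ p ∈ (Γ.tuples cl.1).filter (fun p => p k = true), w j cl p =
        (∑ p ∈ (Γ.tuples cl.1).filter (fun p => p k = true),
          ((C j p : ℝ) - blockSize blk j * w j cl p)) / blockSize blk j := by
      rw [Finset.sum_sub_distrib, ← Finset.mul_sum, sub_div, mul_div_cancel_left₀ _ hn.ne']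
    rw [h₁, abs_div, abs_of_pos hn]
    have h₂ : |∑ p ∈ (Γ.tuples cl.1).filter (fun p => p k = true),
        ((C j p : ℝ) - blockSize blk j * w j cl p)| ≤ ((a * a * m : ℕ) : ℝ) := by
      refine (Finset.abs_sum_le_sum_abs _ _).trans ((Finset.sum_le_card_nsmul _ _
        (((a * m : ℕ) : ℝ)) fun p hp => ?_).trans ?_)
      · refine (hC₂ j p (Finset.mem_of_mem_filter p hp)).2.trans ?_
        exact_mod_cast Nat.mul_le_mul_right m (ha cl.1)
      · rw [nsmul_eq_mul]
        have := (Finset.card_filter_le (Γ.tuples cl.1) (fun p => p k = true)).trans (ha cl.1)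
        rw [mul_assoc]
        exact_mod_cast Nat.mul_le_mul_right (a * m) this
    have h₃ : (ℓ : ℝ) ≤ blockSize blk j := by exact_mod_cast hsize j
    exact (div_le_div_of_nonneg_right h₂ hn.le).trans
      (div_le_div_of_nonneg_left (Nat.cast_nonneg _) hℓ' h₃)
  · have h₁ := ham_le blk (fun l => X l k) j
    have h₂ := hblk.pos j
    rw [div_le_one (by exact_mod_cast h₂)]
    exact_mod_cast h₁

/-! ### Linear systems with named unknowns -/

/-- Names of the unknowns of a linear system. The name `[]` is reserved for the constant `-1`. -/
abbrev Name := List (List Bool)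

/-- The equation that the sum of the unknowns in the first list equals the sum of the unknowns in
the second list. -/
abbrev LinRow := List Name × List Name

/-- The coefficient of an unknown. -/
def coef (r : LinRow) (γ : Name) : ℤ := (if γ ∈ r.1 then 1 else 0) - if γ ∈ r.2 then 1 else 0

/-- Add a name to a list, unless it is reserved or already there. -/
def insertName (s : List Name) (γ : Name) : List Name :=
  if γ = [] ∨ γ ∈ s then s else s ++ [γ]

/-- The unknowns of a linear system. -/
def unknowns (rs : List LinRow) : List Name :=
  (rs.flatMap fun r => r.1 ++ r.2).foldl insertName []

/-- `y` satisfies the equations, and the reserved unknown is `-1`. -/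
def Solves {R : Type*} [Ring R] (rs : List LinRow) (y : Name → R) : Prop :=
  y [] = -1 ∧ ∀ r ∈ rs, (r.1.map y).sum = (r.2.map y).sum

theorem foldl_insertName (l s : List Name) (hs : s.Nodup ∧ [] ∉ s) :
    ((l.foldl insertName s).Nodup ∧ [] ∉ l.foldl insertName s) ∧
      (∀ γ, γ ∈ s ∨ γ ∈ l ∧ γ ≠ [] → γ ∈ l.foldl insertName s) ∧
      (enc (l.foldl insertName s)).length ≤ (enc s).length + (enc l).length := by
  induction l generalizing s with
  | nil => exact ⟨hs, by simp, by simp⟩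
  | cons γ l ih =>
      rw [List.foldl_cons]
      by_cases h : γ = [] ∨ γ ∈ s
      · rw [insertName, if_pos h]
        obtain ⟨h₁, h₂, h₃⟩ := ih s hs
        refine ⟨h₁, fun γ' hγ' => h₂ γ' ?_, by rw [length_enc_cons]; omega⟩
        rw [List.mem_cons] at hγ'
        rcases hγ' with hγ' | ⟨rfl | hγ', hne⟩
        · exact Or.inl hγ'
        · exact Or.inl (h.resolve_left hne)
        · exact Or.inr ⟨hγ', hne⟩
      · rw [insertName, if_neg h]
        rw [not_or] at h
        obtain ⟨h₁, h₂, h₃⟩ := ih (s ++ [γ]) ⟨by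
          rw [List.nodup_append]
          refine ⟨hs.1, by simp, ?_⟩
          rintro a ha b hb rfl
          rw [List.mem_singleton] at hb
          exact h.2 (hb ▸ ha), by
          rw [List.mem_append, List.mem_singleton]
          exact not_or.2 ⟨hs.2, fun e => h.1 e.symm⟩⟩
        refine ⟨h₁, fun γ' hγ' => h₂ γ' ?_, ?_⟩
        · rw [List.mem_cons] at hγ'
          rw [List.mem_append, List.mem_singleton]
          tauto
        · rw [length_enc_append, length_enc_cons, enc_nil] at h₃
          rw [length_enc_cons]
          simp only [List.length_nil] at h₃
          omega

theorem nodup_unknowns (rs : List LinRow) : (unknowns rs).Nodup :=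
  (foldl_insertName _ [] (by simp)).1.1

theorem nil_notMem_unknowns (rs : List LinRow) : [] ∉ unknowns rs :=
  (foldl_insertName _ [] (by simp)).1.2

theorem mem_unknowns {rs : List LinRow} {r : LinRow} (hr : r ∈ rs) {γ : Name}
    (hγ : γ ∈ r.1 ∨ γ ∈ r.2) (hne : γ ≠ []) : γ ∈ unknowns rs :=
  (foldl_insertName _ [] (by simp)).2.1 γ
    (Or.inr ⟨List.mem_flatMap.2 ⟨r, hr, List.mem_append.2 hγ⟩, hne⟩)

section sums
variable {R : Type*} [CommRing R]

theorem sum_map_sub {κ : Type*} (l : List κ) (f g : κ → R) :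
    (l.map fun a => f a - g a).sum = (l.map f).sum - (l.map g).sum := by
  induction l with
  | nil => simp
  | cons a l ih => simp only [List.map_cons, List.sum_cons, ih]; ring

theorem sum_map_neg {κ : Type*} (l : List κ) (f : κ → R) :
    (l.map fun a => -f a).sum = -(l.map f).sum := by
  induction l with
  | nil => simp
  | cons a l ih => simp only [List.map_cons, List.sum_cons, ih]; ring

theorem sum_map_indicator {full l : List Name} (hf : full.Nodup) (hl : l.Nodup) (hs : l ⊆ full)
    (y : Name → R) : (full.map fun γ => (if γ ∈ l then 1 else 0) * y γ).sum = (l.map y).sum := by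
  rw [← List.sum_toFinset _ hf, ← List.sum_toFinset _ hl]
  simp only [ite_mul, one_mul, zero_mul]
  rw [← Finset.sum_filter]
  congr 1
  ext γ
  simp only [Finset.mem_filter, List.mem_toFinset]
  exact ⟨fun h => h.2, fun h => ⟨hs h, h⟩⟩

/-- Coefficients are read off from membership, so a name repeated on one side would count only once;
hence the `Nodup` hypotheses. -/
theorem sum_map_coef {full : List Name} {r : LinRow} (hf : full.Nodup) (h₁ : r.1.Nodup)
    (h₂ : r.2.Nodup) (hs₁ : r.1 ⊆ full) (hs₂ : r.2 ⊆ full) (y : Name → R) :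
    (full.map fun γ => (coef r γ : R) * y γ).sum = (r.1.map y).sum - (r.2.map y).sum := by
  rw [← sum_map_indicator hf h₁ hs₁ y, ← sum_map_indicator hf h₂ hs₂ y, ← sum_map_sub]
  congr 1
  refine List.map_congr_left fun γ _ => ?_
  simp only [coef]
  split_ifs <;> simp

end sums

/-- Extends a solution vector to a valuation of all names. The default `d` is taken to be `-1`,
which gives the reserved name its value. -/
theorem exists_map_eq {R : Type*} {cols : List Name} (hc : cols.Nodup) (x : List R)
    (hx : x.length = cols.length) (d : R) :
    ∃ y : Name → R, cols.map y = x ∧ ∀ γ, γ ∉ cols → y γ = d := by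
  induction cols generalizing x with
  | nil => exact ⟨fun _ => d, (List.length_eq_zero_iff.1 hx).symm, fun _ _ => rfl⟩
  | cons γ cols ih =>
      rcases x with _ | ⟨a, x⟩
      · simp at hx
      · rw [List.nodup_cons] at hc
        obtain ⟨y, hy, hy'⟩ := ih hc.2 x (by simpa using hx)
        refine ⟨Function.update y γ a, ?_, fun γ' h => ?_⟩
        · rw [List.map_cons, Function.update_self, ← hy]
          congr 1
          exact List.map_congr_left fun γ' h =>
            Function.update_of_ne (by rintro rfl; exact hc.1 h) _ _
        · rw [List.mem_cons, not_or] at h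
          rw [Function.update_of_ne h.1, hy' γ' h.2]

/-- No unknown is repeated on one side of an equation. -/
def Simple (rs : List LinRow) : Prop := ∀ r ∈ rs, r.1.Nodup ∧ r.2.Nodup

/-- The reserved name has value `-1`, so its coefficient plays the role of the right-hand side. -/
theorem sum_unknowns_coef {R : Type*} [CommRing R] {rs : List LinRow} (hrs : Simple rs)
    {r : LinRow} (hr : r ∈ rs) {y : Name → R} (hy : y [] = -1) :
    ((unknowns rs).map fun γ => (coef r γ : R) * y γ).sum - coef r [] =
      (r.1.map y).sum - (r.2.map y).sum := by
  have hf : (unknowns rs ++ [[]]).Nodup := by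
    rw [List.nodup_append]
    refine ⟨nodup_unknowns rs, by simp, ?_⟩
    rintro a ha b hb rfl
    rw [List.mem_singleton] at hb
    exact nil_notMem_unknowns rs (hb ▸ ha)
  have hs : ∀ γ, γ ∈ r.1 ∨ γ ∈ r.2 → γ ∈ unknowns rs ++ [[]] := by
    intro γ hγ
    rw [List.mem_append, List.mem_singleton]
    by_cases h : γ = []
    · exact Or.inr h
    · exact Or.inl (mem_unknowns hr hγ h)
  rw [← sum_map_coef hf (hrs r hr).1 (hrs r hr).2 (fun γ h => hs γ (Or.inl h))
    (fun γ h => hs γ (Or.inr h))]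
  simp [hy, sub_eq_add_neg]

/-! ### Solving modulo `m` -/

/-- The augmented matrix of the system modulo `m`. -/
def matrixMod (m : ℕ) (rs : List LinRow) : List (List (ZMod m)) :=
  rs.map fun r => (unknowns rs ++ [[]]).map fun γ => (coef r γ : ZMod m)

theorem exists_solves_zmod_iff {m : ℕ} [NeZero m] {rs : List LinRow} (hrs : Simple rs) :
    (∀ R ∈ eliminate (unknowns rs) (matrixMod m rs), R.headD 0 = 0) ↔
      ∃ y : Name → ZMod m, Solves rs y := by
  have key : ∀ y : Name → ZMod m, y [] = -1 → ((∀ R ∈ matrixMod m rs,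
      dot R ((unknowns rs).map y ++ [-1]) = 0) ↔ Solves rs y) := by
    intro y hy
    rw [Solves, and_iff_right hy, matrixMod, List.forall_mem_map]
    refine forall₂_congr fun r hr => ?_
    rw [← sub_eq_zero (b := (r.2.map y).sum), ← sum_unknowns_coef hrs hr hy, dot,
      show (unknowns rs).map y ++ [-1] = (unknowns rs ++ [[]]).map y by simp [hy],
      List.zipWith_map, List.zipWith_self]
    simp [hy, sub_eq_add_neg]
  rw [eliminate_spec _ _ fun R hR => by
    obtain ⟨r, -, rfl⟩ := List.mem_map.1 hR
    simp]
  constructor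
  · rintro ⟨x, hx, h⟩
    obtain ⟨y, rfl, hy⟩ := exists_map_eq (nodup_unknowns rs) x hx (-1)
    exact ⟨y, (key y (hy _ (nil_notMem_unknowns rs))).1 h⟩
  · rintro ⟨y, hy⟩
    exact ⟨_, by simp, (key y hy.1).2 hy⟩

/-! ### Solving over a subring of the reals -/

/-- The inequalities that are the rows of the linear program: the unknowns are nonnegative and
satisfy the equations. -/
def lpRows (rs : List LinRow) : List LinRow :=
  rs ++ (rs.map fun r => (r.2, r.1)) ++ (unknowns rs).map fun γ => ([], [γ])

/-- The linear program of the equations `rs` for nonnegative unknowns. -/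
def lpSystem (rs : List LinRow) : LPSystem where
  numRows := (lpRows rs).length
  numVars := (unknowns rs).length
  mat i j := coef (lpRows rs)[i] (unknowns rs)[j]
  rhs i := coef (lpRows rs)[i] []

theorem coef_swap (r : LinRow) (γ : Name) : coef (r.2, r.1) γ = -coef r γ := by
  simp [coef]

/-- A row `(l, l')` of the program reads `l ≤ l'`. An equation together with its swap gives both
inequalities, and `([], [γ])` says that `γ` is nonnegative. -/
theorem feasible_lpSystem_iff {A : Subring ℝ} {rs : List LinRow} (hrs : Simple rs) :
    (∃ x : Fin (lpSystem rs).numVars → A, (lpSystem rs).Feasible fun j => (x j : ℝ)) ↔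
      ∃ y : Name → A, Solves rs y ∧ ∀ γ ∈ unknowns rs, 0 ≤ (y γ : ℝ) := by
  have key : ∀ y : Name → A, y [] = -1 →
      ((lpSystem rs).Feasible (fun j => (y (unknowns rs)[j] : ℝ)) ↔
        Solves rs y ∧ ∀ γ ∈ unknowns rs, 0 ≤ (y γ : ℝ)) := by
    intro y hy
    have h₁ : (lpSystem rs).Feasible (fun j => (y (unknowns rs)[j] : ℝ)) ↔ ∀ r ∈ lpRows rs,
        ((unknowns rs).map fun γ => (coef r γ : ℝ) * y γ).sum - coef r [] ≤ 0 := by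
      simp only [sub_nonpos]
      rw [List.forall_mem_iff_getElem, LPSystem.Feasible]
      rw [Fin.forall_iff]
      refine forall₂_congr fun i hi => ?_
      rw [← Fin.sum_univ_fun_getElem]
      rfl
    have h₂ : ∀ r ∈ rs, ((unknowns rs).map fun γ => (coef r γ : ℝ) * y γ).sum - coef r [] =
        (((r.1.map y).sum : A) : ℝ) - ((r.2.map y).sum : A) := by
      intro r hr
      have h := congrArg (A.subtype) (sum_unknowns_coef hrs hr hy)
      rw [map_sub, map_sub, map_list_sum, List.map_map] at h
      simpa [Function.comp_def] using h
    have h₃ : ∀ r : LinRow, ((unknowns rs).map fun γ => (coef (r.2, r.1) γ : ℝ) * y γ).sum -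
        coef (r.2, r.1) [] = -(((unknowns rs).map fun γ => (coef r γ : ℝ) * y γ).sum - coef r []) := by
      intro r
      simp only [coef_swap, Int.cast_neg, neg_mul]
      rw [sum_map_neg]
      ring
    have h₄ : ∀ γ ∈ unknowns rs, ((unknowns rs).map fun γ' => (coef ([], [γ]) γ' : ℝ) * y γ').sum -
        coef ([], [γ]) [] = -(y γ : ℝ) := by
      intro γ hγ
      have hne : ¬ ([] : Name) = γ := by
        rintro rfl
        exact nil_notMem_unknowns rs hγ
      rw [sum_map_coef (nodup_unknowns rs) (by simp) (by simp) (by simp) (by simpa using hγ)]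
      simp [coef, hne]
    rw [h₁, lpRows, List.forall_mem_append, List.forall_mem_append, List.forall_mem_map,
      List.forall_mem_map, Solves, and_iff_right hy]
    refine and_congr ?_ (forall₂_congr fun γ hγ => by rw [h₄ γ hγ, neg_nonpos])
    rw [← forall₂_and]
    refine forall₂_congr fun r hr => ?_
    rw [h₃, h₂ r hr, neg_nonpos, sub_nonpos, sub_nonneg, ← le_antisymm_iff, Subtype.coe_inj]
  constructor
  · rintro ⟨x, hx⟩
    obtain ⟨y, hxy, hy⟩ := exists_map_eq (nodup_unknowns rs) (List.ofFn x)
      (by rw [List.length_ofFn]; rfl) (-1)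
    refine ⟨y, (key y (hy _ (nil_notMem_unknowns rs))).1 ?_⟩
    convert hx using 2 with j
    have h := List.getElem_of_eq hxy (i := j) (by rw [List.length_map]; exact j.2)
    simp only [List.getElem_map, List.getElem_ofFn] at h
    exact congrArg _ h
  · rintro ⟨y, hy⟩
    exact ⟨_, (key y hy.1.1).2 hy⟩

/-! ### The linear system of a formula -/

/-- The name of a clause. -/
def clauseName {s n : ℕ} {ar : Fin s → ℕ} (cl : Σ i : Fin s, Fin (ar i) → Fin n) : Name :=
  encNat cl.1 :: List.ofFn fun k => encNat (cl.2 k)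

/-- The name of the weight of a tuple in a clause. -/
def weightName (c : Name) {a : ℕ} (p : Fin a → Bool) : Name := List.ofFn p :: c

section rows
variable {E : Type*} {φ : Bool → E} (Γ : PromiseTemplate Bool E φ)

/-- The equations of a clause with the relation symbol `i`: the weights of the tuples sum up to
`1`, and their marginals are the values of the variables. -/
noncomputable def clauseRowsAt (i : Fin Γ.size) (c : Name) : List LinRow :=
  -- The reserved name contributes `-1`, so the weights sum to `1`.
  ((Γ.tuples i).toList.map (fun p => weightName c p) ++ [[]], []) ::
    (List.finRange (Γ.ar i)).map fun k =>
      -- Entry `0` of the clause name is the relation symbol, whence the shift `k + 1`.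
      (((Γ.tuples i).filter fun p => p k = true).toList.map (fun p => weightName c p),
        [[c.getD (k + 1) []]])

/-- The equations of a clause. -/
noncomputable def clauseRows (c : Name) : List LinRow :=
  (List.finRange Γ.size).flatMap fun i : Fin Γ.size =>
    if c.headD [] = encNat i then clauseRowsAt Γ i c else []

/-- The equations of a list of clauses. -/
noncomputable def formulaRows (cs : List Name) : List LinRow := cs.flatMap (clauseRows Γ)

variable {Γ}

theorem mem_clauseRows {n : ℕ} {cl : Σ i : Fin Γ.size, Fin (Γ.ar i) → Fin n} {r : LinRow} :
    r ∈ clauseRows Γ (clauseName cl) ↔ r ∈ clauseRowsAt Γ cl.1 (clauseName cl) := by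
  simp only [clauseRows, List.mem_flatMap, List.mem_finRange, true_and]
  constructor
  · rintro ⟨i, hi⟩
    split_ifs at hi with h
    · have : cl.1 = i := Fin.ext (encNat_injective h)
      rwa [this]
    · simp at hi
  · intro h
    exact ⟨cl.1, by rwa [if_pos (show (clauseName cl).headD [] = encNat cl.1 from rfl)]⟩

theorem weightName_injective (c : Name) {a : ℕ} :
    Function.Injective fun p : Fin a → Bool => weightName c p := by
  intro p q h
  exact List.ofFn_injective (List.cons.inj h).1

theorem simple_formulaRows (cs : List Name) : Simple (formulaRows Γ cs) := by
  intro r hr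
  obtain ⟨c, -, hr⟩ := List.mem_flatMap.1 hr
  obtain ⟨i, -, hr⟩ := List.mem_flatMap.1 hr
  split_ifs at hr
  · have hnd : ∀ T : Finset (Fin (Γ.ar i) → Bool),
        (T.toList.map (fun p => weightName c p)).Nodup := fun T =>
      T.nodup_toList.map (weightName_injective c)
    rw [clauseRowsAt, List.mem_cons, List.mem_map] at hr
    rcases hr with rfl | ⟨k, -, rfl⟩
    · refine ⟨?_, by simp⟩
      rw [List.nodup_append]
      refine ⟨hnd _, by simp, ?_⟩
      rintro a ha b hb rfl
      rw [List.mem_singleton] at hb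
      obtain ⟨p, -, hp⟩ := List.mem_map.1 ha
      rw [hb] at hp
      cases hp
    · exact ⟨hnd _, by simp⟩
  · simp at hr

theorem solves_formulaRows_iff {R : Type*} [Ring R] {n : ℕ}
    {cls : List (Σ i : Fin Γ.size, Fin (Γ.ar i) → Fin n)} {y : Name → R} :
    Solves (formulaRows Γ (cls.map clauseName)) y ↔ y [] = -1 ∧ ∀ cl ∈ cls,
      ∑ p ∈ Γ.tuples cl.1, y (weightName (clauseName cl) p) = 1 ∧
      ∀ k, ∑ p ∈ (Γ.tuples cl.1).filter (fun p => p k = true), y (weightName (clauseName cl) p) =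
        y [encNat (cl.2 k)] := by
  rw [Solves]
  refine and_congr_right fun hy => ?_
  have h : (∀ r ∈ formulaRows Γ (cls.map clauseName), (r.1.map y).sum = (r.2.map y).sum) ↔
      ∀ cl ∈ cls, ∀ r ∈ clauseRowsAt Γ cl.1 (clauseName cl),
        (r.1.map y).sum = (r.2.map y).sum := by
    simp only [formulaRows, List.mem_flatMap, List.mem_map]
    constructor
    · exact fun h cl hcl r hr => h r ⟨_, ⟨cl, hcl, rfl⟩, mem_clauseRows.2 hr⟩
    · rintro h r ⟨_, ⟨cl, hcl, rfl⟩, hr⟩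
      exact h cl hcl r (mem_clauseRows.1 hr)
  rw [h]
  refine forall₂_congr fun cl _ => ?_
  rw [clauseRowsAt, List.forall_mem_cons, List.forall_mem_map]
  refine and_congr ?_ ?_
  · simp only [List.map_append, List.map_map, List.sum_append, List.map_cons, List.map_nil,
      List.sum_cons, List.sum_nil, hy, add_zero]
    rw [← sub_eq_add_neg, sub_eq_zero]
    rw [show (fun p => y (weightName (clauseName cl) p)) = y ∘ fun p => weightName _ p from rfl,
      Finset.sum_map_toList]
  · simp only [List.mem_finRange, true_implies, List.map_map, List.map_cons, List.map_nil,
      List.sum_cons, List.sum_nil, add_zero]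
    refine forall_congr' fun k => ?_
    rw [Finset.sum_map_toList]
    simp [clauseName, Function.comp_def]

theorem weightName_mem_unknowns {n : ℕ} {cls : List (Σ i : Fin Γ.size, Fin (Γ.ar i) → Fin n)}
    {cl : Σ i : Fin Γ.size, Fin (Γ.ar i) → Fin n} (hcl : cl ∈ cls) {p : Fin (Γ.ar cl.1) → Bool}
    (hp : p ∈ Γ.tuples cl.1) :
    weightName (clauseName cl) p ∈ unknowns (formulaRows Γ (cls.map clauseName)) := by
  refine mem_unknowns (r := ((Γ.tuples cl.1).toList.map (fun p => weightName (clauseName cl) p) ++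
    [[]], [])) ?_ (Or.inl ?_) (by simp [weightName])
  · exact List.mem_flatMap.2 ⟨_, List.mem_map_of_mem hcl, mem_clauseRows.2 List.mem_cons_self⟩
  · exact List.mem_append_left _ (List.mem_map.2 ⟨p, Finset.mem_toList.2 hp, rfl⟩)

open Classical in
/-- The solution of the linear system that is given by a satisfying assignment. -/
noncomputable def assignmentSolution (R : Type*) [Ring R] {n : ℕ} (x : Fin n → Bool) : Name → R
  | [] => -1
  | [v] => if ∃ i : Fin n, encNat i = v ∧ x i = true then 1 else 0
  | p :: _ :: vs =>
      if p = vs.map fun v => decide (∃ i : Fin n, encNat i = v ∧ x i = true) then 1 else 0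

theorem exists_encNat_iff {n : ℕ} (x : Fin n → Bool) (i : Fin n) :
    (∃ i' : Fin n, encNat i' = encNat i ∧ x i' = true) ↔ x i = true :=
  ⟨fun ⟨i', h, h'⟩ => by rwa [← Fin.ext (encNat_injective h)], fun h => ⟨i, rfl, h⟩⟩

/-- The name of a weight lists the tuple, the symbol and the variables, so the indicator can be
computed from the name alone. Variables have names of length one and weights have longer names, so
they never collide. -/
theorem assignmentSolution_weightName (R : Type*) [Ring R] {n : ℕ} (x : Fin n → Bool)
    (cl : Σ i : Fin Γ.size, Fin (Γ.ar i) → Fin n) (p : Fin (Γ.ar cl.1) → Bool) :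
    assignmentSolution R x (weightName (clauseName cl) p) =
      if p = fun k => x (cl.2 k) then 1 else 0 := by
  have h : (List.ofFn fun k => encNat (cl.2 k)).map
      (fun v => decide (∃ i : Fin n, encNat i = v ∧ x i = true)) =
      List.ofFn fun k => x (cl.2 k) := by
    rw [List.map_ofFn]
    congr 1
    funext k
    simp only [Function.comp_apply, exists_encNat_iff, Bool.decide_eq_true]
  simp only [assignmentSolution, weightName, clauseName]
  rw [h]
  simp only [List.ofFn_injective.eq_iff]

theorem solves_assignmentSolution (R : Type*) [Ring R] (Ψ : Formula Γ.ar)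
    {x : Fin Ψ.numVars → Bool} (hx : ∀ cl ∈ Ψ.clauses, (fun k => x (cl.2 k)) ∈ Γ.P cl.1) :
    Solves (formulaRows Γ (Ψ.clauses.map clauseName)) (assignmentSolution R x) := by
  rw [solves_formulaRows_iff]
  refine ⟨rfl, fun cl hcl => ⟨?_, fun k => ?_⟩⟩
  · simp only [assignmentSolution_weightName]
    rw [Finset.sum_ite_eq' , if_pos (PromiseTemplate.mem_tuples.2 (hx cl hcl))]
  · simp only [assignmentSolution_weightName]
    rw [Finset.sum_ite_eq']
    simp only [Finset.mem_filter, PromiseTemplate.mem_tuples, hx cl hcl, true_and,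
      assignmentSolution, exists_encNat_iff]

theorem assignmentSolution_nonneg (A : Subring ℝ) {n : ℕ} (x : Fin n → Bool) {γ : Name}
    (hγ : γ ≠ []) : 0 ≤ (assignmentSolution A x γ : ℝ) := by
  rcases γ with _ | ⟨p, _ | ⟨v, vs⟩⟩
  · exact absurd rfl hγ
  · simp only [assignmentSolution]; split_ifs <;> simp
  · simp only [assignmentSolution]; split_ifs <;> simp

/-- Solutions of the linear system in the rings `A j` and modulo `m` give an assignment over `E`. -/
theorem satisfiable_of_solves {b : ℕ} {A : Fin b → Subring ℝ}
    (hdense : ∀ j, Dense (A j : Set ℝ)) {s : ℕ} {Part : cube A → Fin s}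
    (hPart : IsOpenPartition Part) {J : Fin s → Ideal (Fin b → ℤ)}
    {M : (k : Fin s) → ((Fin b → ℤ) ⧸ J k) → E}
    (hpol : ∀ ℓ : ℕ, 0 < ℓ → ∃ (L : ℕ) (blk : Fin L → Fin b) (hblk : Admissible Part blk),
      (∀ j, ℓ ≤ blockSize blk j) ∧ Γ.IsPolymorphism (regPer Part J M blk hblk))
    {m : ℕ} [NeZero m] (hm : ∀ k, ∀ u : Fin b → ℤ, (∀ j, (m : ℤ) ∣ u j) → u ∈ J k)
    (Ψ : Formula Γ.ar)
    (hA : ∀ j, ∃ y : Name → A j, Solves (formulaRows Γ (Ψ.clauses.map clauseName)) y ∧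
      ∀ γ ∈ unknowns (formulaRows Γ (Ψ.clauses.map clauseName)), 0 ≤ (y γ : ℝ))
    (hZ : ∃ y : Name → ZMod m, Solves (formulaRows Γ (Ψ.clauses.map clauseName)) y) :
    Ψ.Satisfiable Γ.Q := by
  classical
  choose y hy hy₀ using hA
  obtain ⟨z, hz⟩ := hZ
  simp only [solves_formulaRows_iff] at hy hz
  -- For a variable that occurs in a clause, the marginal equation forces the value into `[0, 1]`.
  -- Any other variable may have an arbitrary value, and `0` replaces it if it lies outside.
  let x : Fin Ψ.numVars → cube A := fun v => ⟨fun j =>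
    if 0 ≤ (y j [encNat v] : ℝ) ∧ (y j [encNat v] : ℝ) ≤ 1 then y j [encNat v] else 0, fun j => by
      beta_reduce
      split_ifs with h
      · exact ⟨(y j _).2, h⟩
      · exact ⟨(A j).zero_mem, le_rfl, zero_le_one⟩⟩
  refine satisfiable_of_weights hdense hPart hpol hm Ψ x
    (fun j cl p => (y j (weightName (clauseName cl) p) : ℝ)) (fun j cl hcl => ?_)
    (fun cl p => z (weightName (clauseName cl) p)) (fun v => z [encNat v]) hz.2
  have h₀ : ∀ p ∈ Γ.tuples cl.1, 0 ≤ (y j (weightName (clauseName cl) p) : ℝ) := fun p hp =>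
    hy₀ j _ (weightName_mem_unknowns hcl hp)
  have h₁ : ∑ p ∈ Γ.tuples cl.1, (y j (weightName (clauseName cl) p) : ℝ) = 1 := by
    exact_mod_cast congrArg (Subtype.val) ((hy j).2 cl hcl).1
  refine ⟨h₀, h₁, fun k => ?_⟩
  have h₂ : ∑ p ∈ (Γ.tuples cl.1).filter (fun p => p k = true),
      (y j (weightName (clauseName cl) p) : ℝ) = y j [encNat (cl.2 k)] := by
    exact_mod_cast congrArg (Subtype.val) (((hy j).2 cl hcl).2 k)
  simp only [x]
  rw [if_pos, h₂]
  rw [← h₂]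
  refine ⟨Finset.sum_nonneg fun p hp => h₀ p (Finset.mem_of_mem_filter p hp), ?_⟩
  rw [← h₁]
  exact Finset.sum_le_sum_of_subset_of_nonneg (Finset.filter_subset _ _) fun p hp _ => h₀ p hp

end rows

/-! ### The algorithm -/

instance instEncLPSystem : Enc LPSystem := ⟨LPSystem.enc⟩

instance instEncFormula {s : ℕ} {ar : Fin s → ℕ} : Enc (Formula ar) := ⟨Formula.enc⟩

namespace PF

variable {α β γ κ : Type*} [Enc α] [Enc β] [Enc γ]

theorem getD {l : α → List β} (hl : PF l) (n : ℕ) (d : β) : PF fun a => (l a).getD n d := by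
  induction n generalizing l with
  | zero => exact (hl.headD d).congr fun a => by cases l a <;> rfl
  | succ n ih => exact (ih hl.listTail).congr fun a => by cases l a <;> rfl

theorem mapConst (L : List κ) {f : κ → α → β} (hf : ∀ k, PF (f k)) :
    PF fun a => L.map fun k => f k a := by
  induction L with
  | nil => exact const []
  | cons k L ih => exact (hf k).cons ih

theorem flatMapConst (L : List κ) {f : κ → α → List β} (hf : ∀ k, PF (f k)) :
    PF fun a => L.flatMap fun k => f k a := by
  induction L with
  | nil => exact const []
  | cons k L ih => exact (hf k).append ih

theorem forallConst (L : List κ) {p : κ → α → Prop} (hp : ∀ k, PD (p k)) :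
    PD fun a => ∀ k ∈ L, p k a := by
  induction L with
  | nil => exact (const true).congr fun a => by simp
  | cons k L ih => exact PF.congr (and (hp k) ih) fun a => by simp

theorem coef {r : α → LinRow} {g : α → Name} (hr : PF r) (hg : PF g) :
    PF fun a => coef (r a) (g a) := by
  refine (ite (mem hg hr.fst) (ite (mem hg hr.snd) (const 0) (const 1))
    (ite (mem hg hr.snd) (const (-1)) (const 0))).congr fun a => ?_
  simp only [PromiseCSP.coef]
  split_ifs <;> rfl

theorem coefMod (m : ℕ) {r : α → LinRow} {g : α → Name} (hr : PF r) (hg : PF g) :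
    PF fun a => (PromiseCSP.coef (r a) (g a) : ZMod m) := by
  refine (ite (mem hg hr.fst) (ite (mem hg hr.snd) (const 0) (const 1))
    (ite (mem hg hr.snd) (const (-1)) (const 0))).congr fun a => ?_
  simp only [PromiseCSP.coef]
  split_ifs <;> simp

end PF

theorem pf_unknowns : PF unknowns := by
  have hl : PF fun rs : List LinRow => rs.flatMap fun r => r.1 ++ r.2 :=
    PF.flatMap (f := fun _ (r : LinRow) => r.1 ++ r.2) PF.id (PF.id.snd.fst.append PF.id.snd.snd)
  have hs : PF fun x : List LinRow × List Name × Name => insertName x.2.1 x.2.2 := by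
    have hn : PD fun x : List LinRow × List Name × Name => ¬ (¬ x.2.2 = [] ∧ ¬ x.2.2 ∈ x.2.1) :=
      PF.not (PF.and (PF.not (PF.eq PF.id.snd.snd (PF.const [])))
        (PF.not (PF.mem PF.id.snd.snd PF.id.snd.fst)))
    refine (PF.ite hn PF.id.snd.fst (PF.id.snd.fst.append
      (PF.id.snd.snd.cons (PF.const [])))).congr fun x => ?_
    rw [insertName]
    congr 1
    simp only [eq_iff_iff]
    tauto
  refine PF.foldl (step := fun _ => insertName) (init := fun _ => []) hl (PF.const []) hs ?_
  obtain ⟨p, hp⟩ := hl.length_le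
  refine ⟨p, fun rs l' hl' => ?_⟩
  have h₁ := (foldl_insertName l' [] (by simp)).2.2
  have h₂ := length_enc_le_of_isPrefix hl'
  have h₃ := hp rs
  beta_reduce at h₃
  simp only [enc_nil, List.length_nil] at h₁
  omega

theorem pf_matrixMod (m : ℕ) : PF (matrixMod m) := by
  have h : PF fun x : (List LinRow × LinRow) × Name => (coef x.1.2 x.2 : ZMod m) :=
    PF.coefMod m PF.id.fst.snd PF.id.snd
  have hu : PF fun x : List LinRow × LinRow => unknowns x.1 ++ [[]] :=
    (pf_unknowns.comp PF.id.fst).append (PF.const [[]])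
  exact PF.map (f := fun rs r => (unknowns rs ++ [[]]).map fun γ => (coef r γ : ZMod m)) PF.id
    (PF.map (f := fun (x : List LinRow × LinRow) γ => (coef x.2 γ : ZMod m)) hu h)

theorem pf_lpRows : PF lpRows := by
  have h₁ : PF fun rs : List LinRow => rs.map fun r => (r.2, r.1) :=
    PF.map (f := fun _ (r : LinRow) => (r.2, r.1)) PF.id (PF.id.snd.snd.pair PF.id.snd.fst)
  have h₂ : PF fun rs : List LinRow => (unknowns rs).map fun γ => (([], [γ]) : LinRow) :=
    PF.map (f := fun _ γ => (([], [γ]) : LinRow)) pf_unknowns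
      ((PF.const []).pair (PF.id.snd.cons (PF.const [])))
  exact (PF.id.append h₁).append h₂

/-- Appending the reserved name to the columns adds the right-hand side as last entry, so the
program is encoded as a plain integer matrix. -/
theorem enc_lpSystem (rs : List LinRow) : (lpSystem rs).enc =
    enc (encUnary (unknowns rs).length,
      [(lpRows rs).map fun r => (unknowns rs ++ [[]]).map fun γ => coef r γ]) := by
  have h : (List.ofFn fun i => encList ((List.ofFn fun j => encInt ((lpSystem rs).mat i j)) ++
      [encInt ((lpSystem rs).rhs i)])) =
      ((lpRows rs).map fun r => (unknowns rs ++ [[]]).map fun γ => coef r γ).map enc := by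
    rw [List.map_map, ← List.ofFn_getElem_eq_map]
    congr 1
    funext i
    simp only [Function.comp_apply, enc, List.map_append, List.map_map, List.map_cons,
      List.map_nil]
    rw [← List.ofFn_getElem_eq_map]
    rfl
  rw [LPSystem.enc, h]
  simp [encList, enc, lpSystem]

theorem pf_lpSystem : PF lpSystem := by
  have hu : PF fun rs : List LinRow => encUnary (unknowns rs).length := by
    have e : ∀ (l : List Name) (w : List Bool), l.foldl (fun w _ => true :: w) w =
        encUnary l.length ++ w := by
      intro l
      induction l with
      | nil => simp [encUnary]
      | cons a l ih =>
          intro w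
          rw [List.foldl_cons, ih, List.length_cons, encUnary, encUnary, List.replicate_succ']
          simp
    refine (PF.foldl (l := unknowns) (init := fun _ => ([] : List Bool))
      (step := fun _ w _ => true :: w) pf_unknowns (PF.const ([] : List Bool))
      (PF.id.snd.fst.stringCons true) ?_).congr fun rs => by rw [e, List.append_nil]
    obtain ⟨p, hp⟩ := pf_unknowns.length_le
    refine ⟨p, fun rs l' hl' => ?_⟩
    have := hl'.length_le.trans ((length_le_length_enc _).trans (hp rs))
    rw [e, enc_string]
    simpa [encUnary] using this
  have hm : PF fun rs : List LinRow => (lpRows rs).map fun r =>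
      (unknowns rs ++ [[]]).map fun γ => coef r γ := by
    have h : PF fun x : (List LinRow × LinRow) × Name => coef x.1.2 x.2 :=
      PF.coef PF.id.fst.snd PF.id.snd
    have hu : PF fun x : List LinRow × LinRow => unknowns x.1 ++ [[]] :=
      (pf_unknowns.comp PF.id.fst).append (PF.const [[]])
    exact PF.map (f := fun rs r => (unknowns rs ++ [[]]).map fun γ => coef r γ) pf_lpRows
      (PF.map (f := fun (x : List LinRow × LinRow) γ => coef x.2 γ) hu h)
  exact Poly.congr (hu.pair (hm.cons (PF.const []))) fun rs => (enc_lpSystem rs).symm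

/-- The linear program of `rs` has a solution in `A`. -/
def LPSystem.FeasibleIn (A : Subring ℝ) (Λ : LPSystem) : Prop :=
  ∃ x : Fin Λ.numVars → A, Λ.Feasible fun j => (x j : ℝ)

/-- Only the first bit of the solver's answer is used; the solution itself is discarded. -/
theorem pf_feasibleIn {A : Subring ℝ} {ρ : RingRep A} (h : ρ.IsLPSolvable) :
    PD (LPSystem.FeasibleIn A) := by
  classical
  obtain ⟨out, ho, hR⟩ := Poly.of_polyTimeSolvable h.2
  have ho' : PF out := ho
  refine PF.stringCases (s := out) ho' (PF.const false) (PF.const false) (PF.const true) ?_ ?_ ?_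
  · intro Λ h
    rcases hR Λ with ⟨_, _, h'⟩ | ⟨_, h'⟩ <;> rw [h'] at h <;> cases h
  · intro Λ w h
    rcases hR Λ with ⟨_, _, h'⟩ | ⟨hn, _⟩
    · rw [h'] at h; cases h
    · exact decide_eq_false hn
  · intro Λ w h
    rcases hR Λ with ⟨u, hu, _⟩ | ⟨_, h'⟩
    · exact decide_eq_true ⟨fun j => (u j).val, hu⟩
    · rw [h'] at h; cases h

/-! ### The acceptance test: running time and correctness. -/

section formula
variable {E : Type*} {φ : Bool → E} (Γ : PromiseTemplate Bool E φ)

theorem pf_formulaRows : PF (formulaRows Γ) := by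
  have hw : ∀ {a : ℕ} (T : List (Fin a → Bool)),
      PF fun c : Name => T.map fun p => weightName c p := fun T =>
    PF.mapConst T fun p => (PF.const (List.ofFn p)).cons PF.id
  have hat : ∀ i, PF (clauseRowsAt Γ i) := fun i =>
    (((hw _).append (PF.const [[]])).pair (PF.const [])).cons (PF.mapConst _ fun k =>
      (hw _).pair (((PF.id.getD (k + 1) []).cons (PF.const [])).cons (PF.const [])))
  have hc : PF (clauseRows Γ) := PF.flatMapConst _ fun i =>
    PF.ite (PF.eq (PF.id.headD []) (PF.const (encNat i))) (hat i) (PF.const [])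
  exact PF.flatMap (f := fun _ c => clauseRows Γ c) PF.id (hc.comp PF.id.snd)

/-- Clause names are exactly the lists encoded in a formula, so the list of names is a projection of
the input string. -/
theorem enc_formula {s : ℕ} {ar : Fin s → ℕ} (Ψ : Formula ar) :
    Ψ.enc = enc (encUnary Ψ.numVars, Ψ.clauses.map clauseName) := by
  simp only [Formula.enc, enc, encList, List.flatMap_cons, List.map_map]
  congr 2
  refine List.map_congr_left fun cl _ => ?_
  simp [clauseName]

theorem pf_clauseNames {s : ℕ} {ar : Fin s → ℕ} :
    PF fun Ψ : Formula ar => Ψ.clauses.map clauseName := by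
  have h : Poly (enc : Formula ar → List Bool)
      fun Ψ => enc (encUnary Ψ.numVars, Ψ.clauses.map clauseName) :=
    (Poly.refl _).congr enc_formula
  exact PF.snd (f := fun Ψ : Formula ar => (encUnary Ψ.numVars, Ψ.clauses.map clauseName)) h

/-- The test that the algorithm performs on the list of the clauses. -/
def Accepts {b : ℕ} (A : Fin b → Subring ℝ) (m : ℕ) [NeZero m] (cs : List Name) : Prop :=
  (∀ j ∈ List.finRange b, (lpSystem (formulaRows Γ cs)).FeasibleIn (A j)) ∧
    ∀ R ∈ eliminate (unknowns (formulaRows Γ cs)) (matrixMod m (formulaRows Γ cs)), R.headD 0 = 0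

theorem pf_accepts {b : ℕ} {A : Fin b → Subring ℝ} {ρ : (j : Fin b) → RingRep (A j)}
    (hA : ∀ j, (ρ j).IsLPSolvable) (m : ℕ) [NeZero m] :
    PD (Accepts Γ A m) := by
  have hr := pf_formulaRows Γ
  have h₁ : PD fun cs => ∀ j ∈ List.finRange b,
      (lpSystem (formulaRows Γ cs)).FeasibleIn (A j) :=
    PF.forallConst (p := fun j cs => (lpSystem (formulaRows Γ cs)).FeasibleIn (A j)) _ fun j =>
      PF.pd_comp (pf_feasibleIn (hA j)) (pf_lpSystem.comp hr)
  have h₂ : PF fun cs => eliminate (unknowns (formulaRows Γ cs)) (matrixMod m (formulaRows Γ cs)) :=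
    PF.eliminate (pf_unknowns.comp hr) ((pf_matrixMod m).comp hr)
  have h₃ : PD fun cs => ∀ R ∈ eliminate (unknowns (formulaRows Γ cs))
      (matrixMod m (formulaRows Γ cs)), R.headD 0 = 0 :=
    PF.forall_mem (p := fun _ (R : List (ZMod m)) => R.headD 0 = 0) h₂
      (PF.eq (PF.id.snd.headD 0) (PF.const 0))
  exact PF.and h₁ h₃

theorem accepts_iff {b : ℕ} {A : Fin b → Subring ℝ} {m : ℕ} [NeZero m] {cs : List Name} :
    Accepts Γ A m cs ↔ (∀ j, ∃ y : Name → A j, Solves (formulaRows Γ cs) y ∧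
      ∀ γ ∈ unknowns (formulaRows Γ cs), 0 ≤ (y γ : ℝ)) ∧
      ∃ y : Name → ZMod m, Solves (formulaRows Γ cs) y := by
  rw [Accepts, exists_solves_zmod_iff (simple_formulaRows cs)]
  simp only [List.mem_finRange, true_implies, LPSystem.FeasibleIn,
    feasible_lpSystem_iff (simple_formulaRows cs)]

theorem accepts_of_satisfiable {b : ℕ} (A : Fin b → Subring ℝ) (m : ℕ) [NeZero m]
    {Ψ : Formula Γ.ar} (h : Ψ.Satisfiable Γ.P) : Accepts Γ A m (Ψ.clauses.map clauseName) := by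
  obtain ⟨x, hx⟩ := h
  refine (accepts_iff Γ).2 ⟨fun j => ⟨_, solves_assignmentSolution (A j) Ψ hx, fun γ hγ => ?_⟩,
    _, solves_assignmentSolution (ZMod m) Ψ hx⟩
  refine assignmentSolution_nonneg (A j) x ?_
  rintro rfl
  exact nil_notMem_unknowns _ hγ

end formula

end PromiseCSP

open PromiseCSP
theorem mainTheorem1
    {b : ℕ} (A : Fin b → Subring ℝ) (ρ : (j : Fin b) → RingRep (A j))
    (hdense : ∀ j, Dense (A j : Set ℝ)) (hA : ∀ j, (ρ j).IsLPSolvable)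
    {s : ℕ} (Part : cube A → Fin s) (hPart : IsOpenPartition Part)
    {E : Type*} [Finite E]
    (J : Fin s → Ideal (Fin b → ℤ)) (hJ : ∀ k, Finite ((Fin b → ℤ) ⧸ J k))
    (M : (k : Fin s) → ((Fin b → ℤ) ⧸ J k) → E)
    {φ : Bool → E} (Γ : PromiseTemplate Bool E φ)
    (hpol : ∀ ℓ : ℕ, 0 < ℓ → ∃ (L : ℕ) (blk : Fin L → Fin b) (hblk : Admissible Part blk),
      (∀ j, ℓ ≤ blockSize blk j) ∧ Γ.IsPolymorphism (regPer Part J M blk hblk)) :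
    Γ.PCSP ∈ PolyTimeClass (partOracle ρ Part) := by
  classical
  obtain ⟨m, hm₀, hm⟩ := exists_modulus J hJ
  have : NeZero m := ⟨hm₀.ne'⟩
  have h : PD fun Ψ : Formula Γ.ar => Accepts Γ A m (Ψ.clauses.map clauseName) :=
    PF.pd_comp (pf_accepts Γ hA m) pf_clauseNames
  -- The promise speaks of strings, so the formula witnessing it may differ from the one indexing
  -- the run. The test sees only the clause names, which the string determines.
  have hinj : ∀ Ψ Ψ' : Formula Γ.ar, Ψ.enc = Ψ'.enc →
      Ψ.clauses.map clauseName = Ψ'.clauses.map clauseName := by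
    intro Ψ Ψ' he
    rw [enc_formula, enc_formula] at he
    exact congrArg Prod.snd (InjEnc.inj he)
  refine Poly.mem_polyTimeClass _ h fun w hw => ?_
  obtain ⟨Ψ, rfl⟩ : ∃ Ψ : Formula Γ.ar, w = Ψ.enc := by
    rcases hw with ⟨Ψ, hΨ, -⟩ | ⟨Ψ, hΨ, -⟩ <;> exact ⟨Ψ, hΨ⟩
  refine ⟨Ψ, rfl, ?_, ?_⟩
  · rintro ⟨Ψ', he, hs⟩
    have := accepts_of_satisfiable Γ A m hs
    rw [← hinj Ψ Ψ' he] at this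
    exact congrArg Enc.enc (decide_eq_true this)
  · rintro ⟨Ψ', he, hs⟩
    have : ¬ Accepts Γ A m (Ψ.clauses.map clauseName) := by
      rw [hinj Ψ Ψ' he]
      intro ha
      obtain ⟨h₁, h₂⟩ := (accepts_iff Γ).1 ha
      exact hs (satisfiable_of_solves hdense hPart hpol hm Ψ' h₁ h₂)
    exact congrArg Enc.enc (decide_eq_false this)
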